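/- **Setting.** Let $k\ge 1$, $n>k$ and $0\le t<T$ be integers, let $\gamma>0$ be the coefficient of absolute risk aversion, $W_t\neq 0$ the wealth at time $t$, and $r_{f,i}$ the risk-free returns, with $R_{f,i}=1+r_{f,i}\ne 0$ for $t+1\le i\le T$. Given a mean vector $\mu\in\mathbb R^k$ and a positive definite $k\times k$ covariance matrix $\Sigma$, the asset returns $X_i$ are i.i.d. $\mathcal N_k(\mu,\Sigma)$. With weights $v$ chosen at time $s$, wealth evolves by $W_{s+1}=W_s\bigl(1+r_{f,s+1}+v^\top(X_{s+1}-r_{f,s+1}\mathbf 1)\bigr)$. The investor maximizes the expected exponential utility $\mathbb E[-\exp(-\gamma W_T)]$ through the Bellman equations $V(T,W)=-\exp(-\gamma W)$, $V(s,W_s)=\max_v \mathbb E\,[V(s+1,W_{s+1})]$. The optimal weights at time $t$, i.e. the unique maximizer in the Bellman equation at time $t$, are $$w_t=C_t\,\Sigma^{-1}(\mu-r_{f,t+1}\mathbf 1),\qquad C_t=\Bigl(\gamma W_t\prod_{i=t+2}^{T}R_{f,i}\Bigr)^{-1}.$$ Let $x=(x_1,\dots,x_n)$ be $n$ observed return vectors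 in $\mathbb R^k$, with sample mean $\bar x_t$ and sample covariance matrix $S_t=\frac1{n-1}\sum_{i}(x_i-\bar x_t)(x_i-\bar x_t)^\top$. The posterior distribution of $(\mu,\Sigma)$ given $x$ has a density, with respect to Lebesgue measure in the entries of $\mu$ and the entries $\sigma_{ij}$, $i\le j$, of the positive definite matrix $\Sigma$, that is proportional to the normal likelihood of $x$ times the prior. **Theorem.** In both cases below the posterior is a proper probability distribution, $w_t$ is integrable with respect to it, and its posterior mean (the Bayes estimate of the optimal weights) is as follows. (a) Diffuse prior $\pi(\mu,\Sigma)\propto|\Sigma|^{-(k+1)/2}$: put $\bar x_{t,d}=\bar x_t$ and $S_{t,d}=(n-1)S_t$. If $S_{t,d}$ is nonsingular, then $$\mathbb E(w_t\mid x)=C_t\,(n-1)\,S_{t,d}^{-1}(\bar x_{t,d}-r_{f,t+1}\mathbf 1).$$ (b) Conjugate prior $\mu\mid\Sigma\sim\mathcal N_k(m_0,\Sigma/r_0)$, $\Sigma\sim\mathcal{IW}_k(d_0,S_0)$, where $m_0\in\mathbb R^k$, $r_0>0$, $d_0>2k$, $S_0$ is positive definite, and $\mathcal{IW}_k(d_0,S_0)$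 is the inverse Wishart distribution with density proportional to $|\Sigma|^{-d_0/2}\exp(-\tfrac12\operatorname{tr}(\Sigma^{-1}S_0))$: put $$\bar x_{t,c}=\frac{n\bar x_t+r_0m_0}{n+r_0},\qquad S_{t,c}=S_{t,d}+S_0+\frac{nr_0}{n+r_0}(m_0-\bar x_t)(m_0-\bar x_t)^\top.$$ Then $$\mathbb E(w_t\mid x)=C_t\,(n+d_0-k-1)\,S_{t,c}^{-1}(\bar x_{t,c}-r_{f,t+1}\mathbf 1).$$ -/

import Mathlib

open MeasureTheory ProbabilityTheory
open scoped Matrix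

namespace BayesPortfolio

noncomputable section

/-! ### The multi-period portfolio choice problem -/

/-- Wealth after one period: from wealth `W`, with risky weights `v`, risk-free return `rf` and
risky returns `y`, the new wealth is `W (1 + rf + vᵀ (y - rf 1))`. -/
def nextWealth {k : ℕ} (rf W : ℝ) (v y : Fin k → ℝ) : ℝ :=
  W * (1 + rf + v ⬝ᵥ fun i => y i - rf)

/-- The value function with `j` periods to go before the horizon `T`, i.e. at time `T - j`, when
the returns are i.i.d. `N_k(μ, Σ)`, given by the Bellman recursion
`V(T, W) = - exp (-γ W)` and
`V(s, W) = sup_v E[V(s + 1, W (1 + r_{s+1} + vᵀ (X_{s+1} - r_{s+1} 1)))]`. -/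
def valueFn {k : ℕ} (γ : ℝ) (r : ℕ → ℝ) (T : ℕ) (μ : Fin k → ℝ) (Sig : Matrix (Fin k) (Fin k) ℝ) :
    ℕ → ℝ → ℝ
  | 0, W => -Real.exp (-γ * W)
  | j + 1, W => ⨆ v : Fin k → ℝ,
      ∫ y, valueFn γ r T μ Sig j (nextWealth (r (T - j)) W v y.ofLp)
        ∂(multivariateGaussian (WithLp.toLp 2 μ) Sig)

/-- `E_t[V(t + 1, W_{t+1})]` when the weights `v` are chosen at time `t < T` with wealth `W`. -/
def objective {k : ℕ} (γ : ℝ) (r : ℕ → ℝ) (T t : ℕ) (W : ℝ) (μ : Fin k → ℝ)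
    (Sig : Matrix (Fin k) (Fin k) ℝ) (v : Fin k → ℝ) : ℝ :=
  ∫ y, valueFn γ r T μ Sig (T - (t + 1)) (nextWealth (r (t + 1)) W v y.ofLp)
    ∂(multivariateGaussian (WithLp.toLp 2 μ) Sig)

/-- `v` is an optimal vector of weights at time `t`: it attains the maximum in the Bellman
equation. -/
def IsOptimalWeight {k : ℕ} (γ : ℝ) (r : ℕ → ℝ) (T t : ℕ) (W : ℝ) (μ : Fin k → ℝ)
    (Sig : Matrix (Fin k) (Fin k) ℝ) (v : Fin k → ℝ) : Prop :=
  ∀ v' : Fin k → ℝ, objective γ r T t W μ Sig v' ≤ objective γ r T t W μ Sig v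

/-- `C_t = (γ W_t ∏_{i=t+2}^T R_i)⁻¹` with `R_i = 1 + r_i`. -/
def coefC (γ : ℝ) (r : ℕ → ℝ) (T t : ℕ) (W : ℝ) : ℝ :=
  (γ * W * ∏ i ∈ Finset.Icc (t + 2) T, (1 + r i))⁻¹

/-- `w_t = C_t Σ⁻¹ (μ - r_{t+1} 1)`. -/
def weight {k : ℕ} (γ : ℝ) (r : ℕ → ℝ) (T t : ℕ) (W : ℝ) (μ : Fin k → ℝ)
    (Sig : Matrix (Fin k) (Fin k) ℝ) : Fin k → ℝ :=
  coefC γ r T t W • (Sig⁻¹ *ᵥ fun i => μ i - r (t + 1))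

/-! ### The space of parameters `(μ, Σ)` -/

/-- A symmetric matrix is given by its entries on and above the diagonal. -/
abbrev SymCoord (k : ℕ) : Type := {p : Fin k × Fin k // p.1 ≤ p.2} → ℝ

/-- The symmetric matrix with the given entries on and above the diagonal. -/
def symMatrix {k : ℕ} (s : SymCoord k) : Matrix (Fin k) (Fin k) ℝ :=
  Matrix.of fun i j => s ⟨(min i j, max i j), min_le_max⟩

/-- The measure `dμ dΣ` on pairs of a vector `μ` and a positive definite matrix `Σ`: Lebesgue
measure in the entries of `μ` and the entries `σ_ij`, `i ≤ j`, of `Σ`. -/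
def paramMeasure (k : ℕ) : Measure ((Fin k → ℝ) × SymCoord k) :=
  (volume : Measure ((Fin k → ℝ) × SymCoord k)).restrict {θ | (symMatrix θ.2).PosDef}

/-! ### Likelihood, priors and posterior -/

/-- The density of `N_k(m, S)` for positive definite `S`. -/
def gaussianDensity {k : ℕ} (m : Fin k → ℝ) (S : Matrix (Fin k) (Fin k) ℝ) (y : Fin k → ℝ) : ℝ :=
  (2 * Real.pi) ^ (-(k : ℝ) / 2) * S.det ^ (-(1 : ℝ) / 2) *
    Real.exp (-((y - m) ⬝ᵥ (S⁻¹ *ᵥ (y - m))) / 2)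

/-- The likelihood of `n` observations that are i.i.d. `N_k(μ, Σ)`. -/
def likelihood {k n : ℕ} (x : Fin n → Fin k → ℝ) (μ : Fin k → ℝ)
    (Sig : Matrix (Fin k) (Fin k) ℝ) : ℝ :=
  ∏ i, gaussianDensity μ Sig (x i)

/-- The diffuse prior `|Σ|^{-(k+1)/2}` (an improper density, up to a constant factor). -/
def diffusePrior {k : ℕ} (_μ : Fin k → ℝ) (Sig : Matrix (Fin k) (Fin k) ℝ) : ℝ :=
  Sig.det ^ (-((k : ℝ) + 1) / 2)

/-- The multivariate gamma function `Γ_k(a)`. -/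
def multiGamma (k : ℕ) (a : ℝ) : ℝ :=
  Real.pi ^ ((k : ℝ) * ((k : ℝ) - 1) / 4) * ∏ i : Fin k, Real.Gamma (a - (i : ℝ) / 2)

/-- The density of the inverse Wishart distribution `IW_k(d, S)`, `d > 2k`, in the parametrization
with density proportional to `|Σ|^{-d/2} exp(-tr(Σ⁻¹ S)/2)`; then
`Σ⁻¹` is Wishart with `d - k - 1` degrees of freedom and scale matrix `S⁻¹`. -/
def invWishartDensity {k : ℕ} (d : ℝ) (S Sig : Matrix (Fin k) (Fin k) ℝ) : ℝ :=
  S.det ^ ((d - k - 1) / 2) /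
      (2 ^ ((k : ℝ) * (d - k - 1) / 2) * multiGamma k ((d - k - 1) / 2)) *
    Sig.det ^ (-d / 2) * Real.exp (-(Sig⁻¹ * S).trace / 2)

/-- The conjugate prior `μ | Σ ∼ N_k(m₀, Σ / r₀)`, `Σ ∼ IW_k(d₀, S₀)`. -/
def conjugatePrior {k : ℕ} (m₀ : Fin k → ℝ) (r₀ d₀ : ℝ) (S₀ : Matrix (Fin k) (Fin k) ℝ)
    (μ : Fin k → ℝ) (Sig : Matrix (Fin k) (Fin k) ℝ) : ℝ :=
  gaussianDensity m₀ (r₀⁻¹ • Sig) μ * invWishartDensity d₀ S₀ Sig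

/-- The measure with density `L(x | μ, Σ) π(μ, Σ)`. -/
def unnormPosterior {k n : ℕ} (prior : (Fin k → ℝ) → Matrix (Fin k) (Fin k) ℝ → ℝ)
    (x : Fin n → Fin k → ℝ) : Measure ((Fin k → ℝ) × SymCoord k) :=
  (paramMeasure k).withDensity fun θ =>
    ENNReal.ofReal (likelihood x θ.1 (symMatrix θ.2) * prior θ.1 (symMatrix θ.2))

/-- The posterior distribution of `(μ, Σ)` given the data `x`, by Bayes' theorem: its density is
proportional to likelihood times prior. -/
def posterior {k n : ℕ} (prior : (Fin k → ℝ) → Matrix (Fin k) (Fin k) ℝ → ℝ)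
    (x : Fin n → Fin k → ℝ) : Measure ((Fin k → ℝ) × SymCoord k) :=
  (unnormPosterior prior x Set.univ)⁻¹ • unnormPosterior prior x

/-- `g(μ, Σ)` has posterior mean `b`: the posterior is a proper probability distribution, the
function is integrable with respect to it, and its expectation is `b`. -/
def HasPosteriorMean {k n : ℕ} (prior : (Fin k → ℝ) → Matrix (Fin k) (Fin k) ℝ → ℝ)
    (x : Fin n → Fin k → ℝ) (g : (Fin k → ℝ) → Matrix (Fin k) (Fin k) ℝ → Fin k → ℝ)
    (b : Fin k → ℝ) : Prop :=
  IsProbabilityMeasure (posterior prior x) ∧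
    Integrable (fun θ => g θ.1 (symMatrix θ.2)) (posterior prior x) ∧
    ∫ θ, g θ.1 (symMatrix θ.2) ∂(posterior prior x) = b

/-! ### Statistics of the data -/

/-- The sample mean `x̄_t`; this is also `x̄_{t,d}`. -/
def sampleMean {k n : ℕ} (x : Fin n → Fin k → ℝ) : Fin k → ℝ :=
  (n : ℝ)⁻¹ • ∑ i, x i

/-- The sample covariance matrix `S_t`. -/
def sampleCov {k n : ℕ} (x : Fin n → Fin k → ℝ) : Matrix (Fin k) (Fin k) ℝ :=
  ((n : ℝ) - 1)⁻¹ •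
    ∑ i, Matrix.vecMulVec (x i - sampleMean x) (x i - sampleMean x)

/-- `S_{t,d} = (n - 1) S_t`. -/
def scatterD {k n : ℕ} (x : Fin n → Fin k → ℝ) : Matrix (Fin k) (Fin k) ℝ :=
  ((n : ℝ) - 1) • sampleCov x

/-- `x̄_{t,c} = (n x̄_t + r₀ m₀) / (n + r₀)`. -/
def meanC {k n : ℕ} (m₀ : Fin k → ℝ) (r₀ : ℝ) (x : Fin n → Fin k → ℝ) : Fin k → ℝ :=
  ((n : ℝ) + r₀)⁻¹ • ((n : ℝ) • sampleMean x + r₀ • m₀)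

/-- `S_{t,c} = S_{t,d} + S₀ + n r₀ (m₀ - x̄_t)(m₀ - x̄_t)ᵀ / (n + r₀)`. -/
def scatterC {k n : ℕ} (m₀ : Fin k → ℝ) (r₀ : ℝ) (S₀ : Matrix (Fin k) (Fin k) ℝ)
    (x : Fin n → Fin k → ℝ) : Matrix (Fin k) (Fin k) ℝ :=
  scatterD x + S₀ +
    ((n : ℝ) * r₀ / ((n : ℝ) + r₀)) • Matrix.vecMulVec (m₀ - sampleMean x) (m₀ - sampleMean x)

end

end BayesPortfolio

open BayesPortfolio

/-!
In the Bellman recursion the value function stays of the form `-A exp (-c W)` with `A > 0`: by the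
Gaussian moment generating function, maximising the expected utility over the weights amounts to
minimising a strictly convex quadratic, whose unique minimiser is a multiple of
`Σ⁻¹ (μ - r_{t+1} 1)`.

Both priors are, up to a constant, normal-inverse-Wishart kernels (the diffuse one with `r₀ = 0`,
`S₀ = 0` and `d₀ = k`), and so is the likelihood; as the product of two such kernels is again one,
the posterior is a normal-inverse-Wishart distribution. The maps `(μ, Σ) ↦ (a + A μ, A Σ Aᵀ)`
permute these distributions, which reduces all questions to mean `0` and scale matrix `1`. There,
orthogonal invariance makes `E Σ⁻¹` a scalar matrix and `E (Σ⁻¹ μ)` zero. The invariance under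
`Σ ↦ c Σ` gives the moment generating function `(1 - 2u) ^ (-k (d - k - 1) / 2)` of `tr Σ⁻¹`, hence
`E Σ⁻¹ = (d - k - 1) 1`. Integrability of the kernel is shown by induction on `k`, splitting off
the first row and column of `Σ` by a Schur complement.
-/

namespace BayesPortfolio

/-! ### Exponential utility and mean-variance weights -/

section Matrix

variable {ι : Type*} [Fintype ι]

lemma dotProduct_mulVec_pos_of_posDef {S : Matrix ι ι ℝ} (hS : S.PosDef) {v : ι → ℝ}
    (hv : v ≠ 0) : 0 < v ⬝ᵥ S *ᵥ v := by
  simpa only [star_trivial] using hS.dotProduct_mulVec_pos hv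

lemma dotProduct_mulVec_nonneg_of_posSemidef {S : Matrix ι ι ℝ} (hS : S.PosSemidef)
    (v : ι → ℝ) : 0 ≤ v ⬝ᵥ S *ᵥ v := by
  simpa only [star_trivial] using hS.dotProduct_mulVec_nonneg v

lemma dotProduct_mulVec_comm_of_isSymm {R : Type*} [CommSemiring R] {S : Matrix ι ι R}
    (hS : S.IsSymm) (u v : ι → R) : u ⬝ᵥ S *ᵥ v = v ⬝ᵥ S *ᵥ u := by
  rw [Matrix.dotProduct_mulVec, ← Matrix.mulVec_transpose, hS.eq, dotProduct_comm]

end Matrix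

section GaussianReturns

variable {ι : Type*} [Fintype ι] [DecidableEq ι] {S : Matrix ι ι ℝ}

lemma map_dotProduct_multivariateGaussian (μ : ι → ℝ) (hS : S.PosSemidef) (v : ι → ℝ) :
    (multivariateGaussian (WithLp.toLp 2 μ) S).map (fun y => v ⬝ᵥ y.ofLp) =
      gaussianReal (v ⬝ᵥ μ) (v ⬝ᵥ S *ᵥ v).toNNReal := by
  set P := multivariateGaussian (WithLp.toLp 2 μ) S
  set L := innerSL ℝ (WithLp.toLp 2 v)
  have hL : ⇑L = fun y => v ⬝ᵥ y.ofLp := by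
    ext y
    simp [L, PiLp.inner_apply, dotProduct, mul_comm]
  have hP : MemLp id 2 P := IsGaussian.memLp_two_id
  have hmean : ∫ y, L y ∂P = v ⬝ᵥ μ := by
    have h := L.integral_comp_comm (hP.integrable (by norm_num))
    simp only [id_eq] at h
    rw [h, integral_id_multivariateGaussian, hL]
  have hvar : Var[L; P] = v ⬝ᵥ S *ᵥ v := by
    refine (covarianceBilin_self hP (WithLp.toLp 2 v)).symm.trans ?_
    rw [covarianceBilin_multivariateGaussian hS]
  rw [← hL, IsGaussian.map_eq_gaussianReal L, hmean, hvar]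

lemma integral_exp_dotProduct_multivariateGaussian (μ : ι → ℝ) (hS : S.PosSemidef) (v : ι → ℝ)
    (a : ℝ) :
    ∫ y, Real.exp (a * (v ⬝ᵥ y.ofLp)) ∂(multivariateGaussian (WithLp.toLp 2 μ) S) =
      Real.exp (a * (v ⬝ᵥ μ) + a ^ 2 / 2 * (v ⬝ᵥ S *ᵥ v)) := by
  have hmgf := mgf_gaussianReal (map_dotProduct_multivariateGaussian μ hS v) a
  rw [mgf] at hmgf
  rw [hmgf, Real.coe_toNNReal _ (dotProduct_mulVec_nonneg_of_posSemidef hS v)]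
  ring_nf

lemma dotProduct_ne_ae_multivariateGaussian (μ : ι → ℝ) (hS : S.PosDef) {v : ι → ℝ} (hv : v ≠ 0)
    (c : ℝ) : ∀ᵐ y ∂(multivariateGaussian (WithLp.toLp 2 μ) S), v ⬝ᵥ y.ofLp ≠ c := by
  have hmeas : Measurable fun y : EuclideanSpace ℝ ι => v ⬝ᵥ y.ofLp := by
    unfold dotProduct
    fun_prop
  have := nullSingletonClass_gaussianReal (μ := v ⬝ᵥ μ) (v := (v ⬝ᵥ S *ᵥ v).toNNReal)
    (Real.toNNReal_pos.2 (dotProduct_mulVec_pos_of_posDef hS hv)).ne'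
  rw [← map_dotProduct_multivariateGaussian μ hS.posSemidef v] at this
  exact ae_of_ae_map hmeas.aemeasurable (compl_mem_ae_iff.2 (measure_singleton c))

end GaussianReturns

section MeanVariance

variable {ι : Type*} [Fintype ι]

/-- The mean-variance criterion `-b vᵀm + b² vᵀSv / 2` of the weights `v`: the logarithm of the
expectation of `exp (-b vᵀY)` for a normal vector `Y` with mean `m` and covariance matrix `S`. -/
noncomputable def meanVariance (b : ℝ) (m : ι → ℝ) (S : Matrix ι ι ℝ) (v : ι → ℝ) : ℝ :=
  -b * (v ⬝ᵥ m) + b ^ 2 / 2 * (v ⬝ᵥ S *ᵥ v)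

variable [DecidableEq ι] {S : Matrix ι ι ℝ} {b : ℝ}

lemma meanVariance_inv_smul (hS : S.PosDef) (hb : b ≠ 0) (m : ι → ℝ) :
    meanVariance b m S (b⁻¹ • S⁻¹ *ᵥ m) = -(m ⬝ᵥ S⁻¹ *ᵥ m) / 2 := by
  rw [meanVariance, Matrix.mulVec_smul, Matrix.mulVec_mulVec,
    Matrix.mul_nonsing_inv _ hS.det_pos.ne'.isUnit, Matrix.one_mulVec]
  simp only [smul_dotProduct, dotProduct_smul, smul_eq_mul, dotProduct_comm (S⁻¹ *ᵥ m)]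
  field_simp
  ring

lemma meanVariance_add (hS : S.PosDef) (hb : b ≠ 0) (m u : ι → ℝ) :
    meanVariance b m S (b⁻¹ • S⁻¹ *ᵥ m + u) =
      meanVariance b m S (b⁻¹ • S⁻¹ *ᵥ m) + b ^ 2 / 2 * (u ⬝ᵥ S *ᵥ u) := by
  set w := b⁻¹ • S⁻¹ *ᵥ m
  have hw : S *ᵥ w = b⁻¹ • m := by
    rw [Matrix.mulVec_smul, Matrix.mulVec_mulVec, Matrix.mul_nonsing_inv _ hS.det_pos.ne'.isUnit,
      Matrix.one_mulVec]
  have hwu : w ⬝ᵥ S *ᵥ u = b⁻¹ * (u ⬝ᵥ m) := by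
    rw [dotProduct_mulVec_comm_of_isSymm (Matrix.isHermitian_iff_isSymm.1 hS.isHermitian), hw,
      dotProduct_smul, smul_eq_mul]
  have huw : u ⬝ᵥ S *ᵥ w = b⁻¹ * (u ⬝ᵥ m) := by rw [hw, dotProduct_smul, smul_eq_mul]
  simp only [meanVariance, Matrix.mulVec_add, add_dotProduct, dotProduct_add, hwu, huw]
  field_simp
  ring

lemma meanVariance_le (hS : S.PosDef) (hb : b ≠ 0) (m v : ι → ℝ) :
    meanVariance b m S (b⁻¹ • S⁻¹ *ᵥ m) ≤ meanVariance b m S v := by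
  rw [← add_sub_cancel (b⁻¹ • S⁻¹ *ᵥ m) v, meanVariance_add hS hb]
  exact le_add_of_nonneg_right
    (mul_nonneg (by positivity) (dotProduct_mulVec_nonneg_of_posSemidef hS.posSemidef _))

lemma forall_meanVariance_le_iff (hS : S.PosDef) (hb : b ≠ 0) (m v : ι → ℝ) :
    (∀ v', meanVariance b m S v ≤ meanVariance b m S v') ↔ v = b⁻¹ • S⁻¹ *ᵥ m := by
  refine ⟨fun hv => ?_, fun hv => hv ▸ meanVariance_le hS hb m⟩
  by_contra hne
  have hmin := hv (b⁻¹ • S⁻¹ *ᵥ m)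
  rw [← add_sub_cancel (b⁻¹ • S⁻¹ *ᵥ m) v, meanVariance_add hS hb] at hmin
  have hquad : 0 < b ^ 2 / 2 * _ :=
    mul_pos (by positivity) (dotProduct_mulVec_pos_of_posDef hS (sub_ne_zero.2 hne))
  linarith

end MeanVariance

section Bellman

variable {k : ℕ} {S : Matrix (Fin k) (Fin k) ℝ}

lemma nextWealth_eq_add_dotProduct (rf W : ℝ) (v y : Fin k → ℝ) :
    nextWealth rf W v y = W * (1 + rf - v ⬝ᵥ fun _ => rf) + W * (v ⬝ᵥ y) := by
  rw [nextWealth, show (fun i => y i - rf) = y - fun _ => rf from rfl, dotProduct_sub]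
  ring

lemma nextWealth_ne_zero_ae (μ : Fin k → ℝ) (hS : S.PosDef) {rf W : ℝ} (hW : W ≠ 0)
    (hrf : 1 + rf ≠ 0) (v : Fin k → ℝ) :
    ∀ᵐ y ∂(multivariateGaussian (WithLp.toLp 2 μ) S), nextWealth rf W v y.ofLp ≠ 0 := by
  rcases eq_or_ne v 0 with rfl | hv
  · exact .of_forall fun y => by simp [nextWealth, hW, hrf]
  filter_upwards [dotProduct_ne_ae_multivariateGaussian μ hS hv ((v ⬝ᵥ fun _ => rf) - (1 + rf))]
    with y hy
  rw [nextWealth_eq_add_dotProduct, ← mul_add]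
  exact mul_ne_zero hW fun h => hy (by linarith)

lemma integral_comp_nextWealth (μ : Fin k → ℝ) (hS : S.PosDef) {rf W A c : ℝ} (hW : W ≠ 0)
    (hrf : 1 + rf ≠ 0) {f : ℝ → ℝ} (hf : ∀ w, w ≠ 0 → f w = -A * Real.exp (-c * w))
    (v : Fin k → ℝ) :
    ∫ y, f (nextWealth rf W v y.ofLp) ∂(multivariateGaussian (WithLp.toLp 2 μ) S) =
      -(A * Real.exp (-c * ((1 + rf) * W))) *
        Real.exp (meanVariance (c * W) (fun i => μ i - rf) S v) := by
  have hutility : ∀ᵐ y ∂(multivariateGaussian (WithLp.toLp 2 μ) S),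
      f (nextWealth rf W v y.ofLp) =
        -A * Real.exp (-c * (W * (1 + rf - v ⬝ᵥ fun _ => rf))) *
          Real.exp (-(c * W) * (v ⬝ᵥ y.ofLp)) := by
    filter_upwards [nextWealth_ne_zero_ae μ hS hW hrf v] with y hy
    rw [hf _ hy, mul_assoc, ← Real.exp_add, nextWealth_eq_add_dotProduct]
    ring_nf
  rw [integral_congr_ae hutility, integral_const_mul,
    integral_exp_dotProduct_multivariateGaussian μ hS.posSemidef, neg_mul_eq_neg_mul A,
    mul_assoc (-A) (Real.exp _), mul_assoc (-A) (Real.exp _), ← Real.exp_add, ← Real.exp_add,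
    meanVariance, show (fun i => μ i - rf) = μ - fun _ => rf from rfl, dotProduct_sub]
  ring_nf

lemma exists_valueFn_eq (μ : Fin k → ℝ) (hS : S.PosDef) {γ : ℝ} (hγ : γ ≠ 0) (r : ℕ → ℝ)
    {T j s : ℕ} (hs : s + j = T) (hr : ∀ i ∈ Finset.Icc (s + 1) T, 1 + r i ≠ 0) :
    ∃ A : ℝ, 0 < A ∧ ∀ w : ℝ, w ≠ 0 → valueFn γ r T μ S j w =
      -A * Real.exp (-(γ * ∏ i ∈ Finset.Icc (s + 1) T, (1 + r i)) * w) := by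
  induction j generalizing s with
  | zero => exact ⟨1, one_pos, fun w _ => by simp [valueFn, ← hs]⟩
  | succ j ih =>
    have hIcc : Finset.Icc (s + 1) T = insert (s + 1) (Finset.Icc (s + 2) T) :=
      (Finset.insert_Icc_add_one_left_eq_Icc (by omega)).symm
    obtain ⟨hrf, hr'⟩ := (Finset.forall_mem_insert ..).1 (hIcc ▸ hr)
    obtain ⟨A, hA, hf⟩ := ih (s := s + 1) (by omega) hr'
    rw [hIcc, Finset.prod_insert (by simp)]
    set P := ∏ i ∈ Finset.Icc (s + 2) T, (1 + r i)
    set m : Fin k → ℝ := fun i => μ i - r (s + 1)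
    refine ⟨A * Real.exp (-(m ⬝ᵥ S⁻¹ *ᵥ m) / 2), by positivity, fun w hw => ?_⟩
    have hb : γ * P * w ≠ 0 := mul_ne_zero (mul_ne_zero hγ (Finset.prod_ne_zero_iff.2 hr')) hw
    have hvalue (v : Fin k → ℝ) := integral_comp_nextWealth μ hS hw hrf hf v
    simp only [valueFn, show T - j = s + 1 by omega, hvalue]
    change ⨆ v, _ * Real.exp (meanVariance (γ * P * w) m S v) = _
    rw [IsLUB.ciSup_eq (IsGreatest.isLUB ⟨⟨(γ * P * w)⁻¹ • S⁻¹ *ᵥ m, rfl⟩, ?_⟩)]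
    rotate_left
    · rintro _ ⟨v, rfl⟩
      exact mul_le_mul_of_nonpos_left (Real.exp_le_exp.2 (meanVariance_le hS hb m v))
        (neg_nonpos.2 (by positivity))
    · rw [meanVariance_inv_smul hS hb]
      ring_nf

theorem isOptimalWeight_iff (μ : Fin k → ℝ) (hS : S.PosDef) {γ W : ℝ} (hγ : γ ≠ 0) (hW : W ≠ 0)
    {r : ℕ → ℝ} {T t : ℕ} (ht : t < T) (hr : ∀ i ∈ Finset.Icc (t + 1) T, 1 + r i ≠ 0)
    (v : Fin k → ℝ) :
    IsOptimalWeight γ r T t W μ S v ↔ v = weight γ r T t W μ S := by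
  obtain ⟨hrf, hr'⟩ : 1 + r (t + 1) ≠ 0 ∧ ∀ i ∈ Finset.Icc (t + 2) T, 1 + r i ≠ 0 :=
    (Finset.forall_mem_insert ..).1
      (Finset.insert_Icc_add_one_left_eq_Icc (show t + 1 ≤ T from ht) ▸ hr)
  obtain ⟨A, hA, hf⟩ := exists_valueFn_eq μ hS hγ r (show t + 1 + (T - (t + 1)) = T by omega) hr'
  have hobjective (v : Fin k → ℝ) : objective γ r T t W μ S v = _ :=
    integral_comp_nextWealth μ hS hW hrf hf v
  have hb := mul_ne_zero (mul_ne_zero hγ (Finset.prod_ne_zero_iff.2 hr')) hW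
  rw [weight, coefC, mul_right_comm, ← forall_meanVariance_le_iff hS hb]
  refine forall_congr' fun v' => ?_
  rw [hobjective, hobjective, mul_le_mul_left_of_neg (neg_neg_of_pos (by positivity)),
    Real.exp_le_exp]

end Bellman

/-! ### Symmetric matrices in coordinates -/

section SymCoord

variable {k : ℕ}

lemma symMatrix_apply (s : SymCoord k) (i j : Fin k) :
    symMatrix s i j = s ⟨(min i j, max i j), min_le_max⟩ := rfl

lemma isSymm_symMatrix (s : SymCoord k) : (symMatrix s).IsSymm := by
  ext i j
  simp only [Matrix.transpose_apply, symMatrix_apply, min_comm, max_comm]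

/-- The entries of a matrix on and above the diagonal; the inverse of `symMatrix` on symmetric
matrices. -/
def symCoord (M : Matrix (Fin k) (Fin k) ℝ) : SymCoord k := fun p => M p.1.1 p.1.2

lemma symMatrix_symCoord {M : Matrix (Fin k) (Fin k) ℝ} (hM : M.IsSymm) :
    symMatrix (symCoord M) = M := by
  ext i j
  rcases le_total i j with h | h
  · simp [symMatrix_apply, symCoord, h]
  · simp [symMatrix_apply, symCoord, h, hM.apply]

lemma symCoord_symMatrix (s : SymCoord k) : symCoord (symMatrix s) = s := by
  ext ⟨⟨i, j⟩, h : i ≤ j⟩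
  simp [symCoord, symMatrix_apply, h]

lemma symMatrix_injective : Function.Injective (symMatrix (k := k)) :=
  Function.LeftInverse.injective symCoord_symMatrix

/-- The congruence `Σ ↦ A Σ Aᵀ` as a linear map in the coordinates on and above the diagonal. -/
def symConj (A : Matrix (Fin k) (Fin k) ℝ) : SymCoord k →ₗ[ℝ] SymCoord k where
  toFun s := symCoord (A * symMatrix s * Aᵀ)
  map_add' s s' := by
    have hadd : symMatrix (s + s') = symMatrix s + symMatrix s' := rfl
    ext p
    simp [symCoord, hadd, mul_add, add_mul]
  map_smul' c s := by
    have hsmul : symMatrix (c • s) = c • symMatrix s := rfl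
    ext p
    simp [symCoord, hsmul]

lemma symMatrix_symConj (A : Matrix (Fin k) (Fin k) ℝ) (s : SymCoord k) :
    symMatrix (symConj A s) = A * symMatrix s * Aᵀ :=
  symMatrix_symCoord (M := A * symMatrix s * Aᵀ) (by
    simp [Matrix.IsSymm, Matrix.transpose_mul, (isSymm_symMatrix s).eq, mul_assoc])

lemma det_symConj_ne_zero {A : Matrix (Fin k) (Fin k) ℝ} (hA : A.det ≠ 0) :
    LinearMap.det (symConj A) ≠ 0 := by
  have hinv : symConj A ∘ₗ symConj A⁻¹ = LinearMap.id := by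
    refine LinearMap.ext fun s => symMatrix_injective ?_
    simp only [LinearMap.comp_apply, symMatrix_symConj, LinearMap.id_apply]
    rw [← mul_assoc, ← mul_assoc, Matrix.mul_nonsing_inv _ hA.isUnit, one_mul, mul_assoc,
      ← Matrix.transpose_mul, Matrix.mul_nonsing_inv _ hA.isUnit, Matrix.transpose_one, mul_one]
  have hdet := congrArg LinearMap.det hinv
  rw [LinearMap.det_comp, LinearMap.det_id] at hdet
  exact left_ne_zero_of_mul_eq_one hdet

lemma symConj_smul_one (c : ℝ) :
    symConj (c • (1 : Matrix (Fin k) (Fin k) ℝ)) = c ^ 2 • LinearMap.id := by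
  refine LinearMap.ext fun s => symMatrix_injective ?_
  rw [symMatrix_symConj]
  ext i j
  simp [symMatrix_apply, sq, mul_assoc]

lemma two_mul_card_symIndex (k : ℕ) :
    2 * (Fintype.card {p : Fin k × Fin k // p.1 ≤ p.2} : ℝ) = k * (k + 1) := by
  rw [← Fintype.card_congr (Sym2.sortEquiv (α := Fin k)), Sym2.card, Fintype.card_fin,
    Nat.cast_choose_two]
  push_cast
  ring

lemma det_symConj_sqrt_smul_one {t : ℝ} (ht : 0 < t) :
    LinearMap.det (symConj (√t • (1 : Matrix (Fin k) (Fin k) ℝ))) =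
      t ^ ((k : ℝ) * (k + 1) / 2) := by
  rw [symConj_smul_one, LinearMap.det_smul, LinearMap.det_id, mul_one, Real.sq_sqrt ht.le,
    Module.finrank_fintype_fun_eq_card, ← Real.rpow_natCast, ← two_mul_card_symIndex]
  ring_nf

lemma continuous_symMatrix : Continuous (symMatrix (k := k)) :=
  continuous_matrix fun i j => by
    simp only [symMatrix_apply]
    fun_prop

lemma posDef_symMatrix_iff (s : SymCoord k) :
    (symMatrix s).PosDef ↔
      ∀ v ∈ Metric.sphere (0 : Fin k → ℝ) 1, 0 < v ⬝ᵥ symMatrix s *ᵥ v := by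
  refine ⟨fun hs v hv => dotProduct_mulVec_pos_of_posDef hs (ne_zero_of_mem_unit_sphere ⟨v, hv⟩),
    fun hs => .of_dotProduct_mulVec_pos
      (Matrix.isHermitian_iff_isSymm.2 (isSymm_symMatrix s)) fun v hv => ?_⟩
  have hnorm : 0 < ‖v‖ := norm_pos_iff.2 hv
  have hunit := hs (‖v‖⁻¹ • v) (by simp [norm_smul, hnorm.ne'])
  rw [Matrix.mulVec_smul, dotProduct_smul, smul_dotProduct, smul_smul, smul_eq_mul] at hunit
  simpa using (pos_iff_pos_of_mul_pos hunit).1 (by positivity)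

lemma isOpen_posDef_symMatrix : IsOpen {s : SymCoord k | (symMatrix s).PosDef} := by
  rw [isOpen_iff_eventually]
  intro s hs
  have hcont : Continuous fun p : SymCoord k × (Fin k → ℝ) => p.2 ⬝ᵥ symMatrix p.1 *ᵥ p.2 :=
    continuous_snd.dotProduct
      ((continuous_symMatrix.comp continuous_fst).matrix_mulVec continuous_snd)
  have hnear := (isCompact_sphere (0 : Fin k → ℝ) 1).eventually_forall_of_forall_eventually
    (x₀ := s) (P := fun s v => 0 < v ⬝ᵥ symMatrix s *ᵥ v) fun v hv =>
      (hcont.continuousAt (x := (s, v))).eventually_const_lt ((posDef_symMatrix_iff s).1 hs v hv)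
  exact hnear.mono fun s' => (posDef_symMatrix_iff s').2

lemma measurable_det_symMatrix : Measurable fun s : SymCoord k => (symMatrix s).det :=
  continuous_symMatrix.matrix_det.measurable

lemma measurable_inv_symMatrix_apply (i j : Fin k) :
    Measurable fun s : SymCoord k => (symMatrix s)⁻¹ i j := by
  simp only [Matrix.inv_def, Ring.inverse_eq_inv', Matrix.smul_apply, smul_eq_mul]
  exact measurable_det_symMatrix.inv.mul
    (continuous_symMatrix.matrix_adjugate.matrix_elem i j).measurable

end SymCoord

/-! ### The normal-inverse-Wishart kernel and its affine equivariance -/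

section Congruence

variable {ι : Type*} [Fintype ι] [DecidableEq ι]

lemma inv_mul_mul_transpose {R : Type*} [CommRing R] (A M : Matrix ι ι R) :
    (A * M * Aᵀ)⁻¹ = (A⁻¹)ᵀ * M⁻¹ * A⁻¹ := by
  rw [Matrix.mul_inv_rev, Matrix.mul_inv_rev, Matrix.transpose_nonsing_inv, mul_assoc]

lemma posDef_mul_mul_transpose_iff {A : Matrix ι ι ℝ} (hA : A.det ≠ 0) {M : Matrix ι ι ℝ} :
    (A * M * Aᵀ).PosDef ↔ M.PosDef := by
  have := Matrix.IsUnit.posDef_star_right_conjugate_iff (x := M)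
    ((Matrix.isUnit_iff_isUnit_det A).2 hA.isUnit)
  rwa [Matrix.star_eq_conjTranspose, Matrix.conjTranspose_eq_transpose_of_trivial] at this

end Congruence

section Kernel

variable {ι : Type*} [Fintype ι] [DecidableEq ι]

/-- The quadratic exponent `κ (μ - m)ᵀ Σ⁻¹ (μ - m) + tr (Σ⁻¹ S)` of the normal-inverse-Wishart
density. -/
noncomputable def niwExponent (κ : ℝ) (m : ι → ℝ) (S : Matrix ι ι ℝ) (μ : ι → ℝ)
    (Sig : Matrix ι ι ℝ) : ℝ :=
  κ * ((μ - m) ⬝ᵥ Sig⁻¹ *ᵥ (μ - m)) + (Sig⁻¹ * S).trace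

/-- The unnormalised density of the normal-inverse-Wishart distribution `μ ∣ Σ ∼ N (m, Σ / κ)`,
`Σ ∼ IW (d, S)`, where `d` follows the parametrization of `invWishartDensity`. The further factor
`|Σ| ^ (-1/2)` comes from the normal density of `μ`. -/
noncomputable def niwDensity (κ : ℝ) (m : ι → ℝ) (S : Matrix ι ι ℝ) (d : ℝ) (μ : ι → ℝ)
    (Sig : Matrix ι ι ℝ) : ℝ :=
  Sig.det ^ (-(d + 1) / 2) * Real.exp (-niwExponent κ m S μ Sig / 2)

lemma niwDensity_pos (κ : ℝ) (m : ι → ℝ) (S : Matrix ι ι ℝ) (d : ℝ) (μ : ι → ℝ)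
    {Sig : Matrix ι ι ℝ} (hSig : Sig.PosDef) : 0 < niwDensity κ m S d μ Sig :=
  mul_pos (Real.rpow_pos_of_pos hSig.det_pos _) (Real.exp_pos _)

lemma niwDensity_mul_exp_mul_niwExponent (κ κ' : ℝ) (m : ι → ℝ) (S : Matrix ι ι ℝ) (d u : ℝ)
    (μ : ι → ℝ) (Sig : Matrix ι ι ℝ) :
    niwDensity κ m S d μ Sig * Real.exp (u * niwExponent κ' m S μ Sig) =
      niwDensity (κ - 2 * u * κ') m ((1 - 2 * u) • S) d μ Sig := by
  rw [niwDensity, mul_assoc, ← Real.exp_add, niwDensity]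
  simp only [niwExponent, Matrix.mul_smul, Matrix.trace_smul, smul_eq_mul]
  ring_nf

variable {A : Matrix ι ι ℝ}

lemma niwExponent_congruence (hA : A.det ≠ 0) (a : ι → ℝ) (κ : ℝ) (m : ι → ℝ)
    (S : Matrix ι ι ℝ) (μ : ι → ℝ) (Sig : Matrix ι ι ℝ) :
    niwExponent κ (a + A *ᵥ m) (A * S * Aᵀ) (a + A *ᵥ μ) (A * Sig * Aᵀ) =
      niwExponent κ m S μ Sig := by
  have hAA : A⁻¹ * A = 1 := Matrix.nonsing_inv_mul _ hA.isUnit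
  have hquad (v : ι → ℝ) : (A *ᵥ v) ⬝ᵥ ((A⁻¹)ᵀ * Sig⁻¹ * A⁻¹) *ᵥ (A *ᵥ v) =
      v ⬝ᵥ Sig⁻¹ *ᵥ v := by
    rw [Matrix.mulVec_mulVec, mul_assoc, hAA, mul_one, ← Matrix.mulVec_mulVec,
      Matrix.dotProduct_mulVec, Matrix.vecMul_transpose, Matrix.mulVec_mulVec, hAA,
      Matrix.one_mulVec]
  have htrace : ((A⁻¹)ᵀ * Sig⁻¹ * A⁻¹ * (A * S * Aᵀ)).trace = (Sig⁻¹ * S).trace := by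
    rw [show (A⁻¹)ᵀ * Sig⁻¹ * A⁻¹ * (A * S * Aᵀ) = (A⁻¹)ᵀ * (Sig⁻¹ * (A⁻¹ * A) * S * Aᵀ) by
        simp only [mul_assoc], hAA, mul_one, Matrix.trace_mul_comm, mul_assoc,
      ← Matrix.transpose_mul, hAA, Matrix.transpose_one, mul_one]
  rw [niwExponent, add_sub_add_left_eq_sub, ← Matrix.mulVec_sub, inv_mul_mul_transpose, hquad,
    htrace, niwExponent]

lemma niwDensity_congruence (hA : A.det ≠ 0) (a : ι → ℝ) (κ : ℝ) (m : ι → ℝ) (S : Matrix ι ι ℝ)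
    (d : ℝ) (μ : ι → ℝ) {Sig : Matrix ι ι ℝ} (hSig : 0 ≤ Sig.det) :
    niwDensity κ m S d μ Sig = |A.det| ^ (d + 1) *
      niwDensity κ (a + A *ᵥ m) (A * S * Aᵀ) d (a + A *ᵥ μ) (A * Sig * Aᵀ) := by
  have hdet : (A * Sig * Aᵀ).det = |A.det| ^ (2 : ℝ) * Sig.det := by
    rw [Matrix.det_mul, Matrix.det_mul, Matrix.det_transpose, Real.rpow_two, sq_abs]
    ring
  rw [niwDensity, niwDensity, niwExponent_congruence hA, hdet, Real.mul_rpow (by positivity) hSig,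
    ← Real.rpow_mul (abs_nonneg _), ← mul_assoc, ← mul_assoc, ← Real.rpow_add (abs_pos.2 hA),
    show d + 1 + 2 * (-(d + 1) / 2) = 0 by ring, Real.rpow_zero, one_mul]

end Kernel

section Measure

variable {α β : Type*} [MeasurableSpace α] [MeasurableSpace β]

lemma map_withDensity_comp (ν : Measure α) {f : α → β} (hf : Measurable f)
    {g : β → ENNReal} (hg : Measurable g) :
    (ν.withDensity (g ∘ f)).map f = (ν.map f).withDensity g := by
  ext s hs
  rw [Measure.map_apply hf hs, withDensity_apply _ (hf hs), withDensity_apply _ hs,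
    setLIntegral_map hs hg hf]
  rfl

lemma inv_univ_smul_smul {c : ENNReal} (hc : c ≠ 0) (hc' : c ≠ ⊤) (ν : Measure α) :
    ((c • ν) Set.univ)⁻¹ • c • ν = (ν Set.univ)⁻¹ • ν := by
  rw [Measure.smul_apply, smul_eq_mul, ENNReal.mul_inv (.inl hc) (.inl hc'), smul_smul,
    mul_right_comm, ENNReal.inv_mul_cancel hc hc', one_mul]

lemma map_inv_univ_smul (ν : Measure α) {f : α → β} (hf : Measurable f) :
    ((ν Set.univ)⁻¹ • ν).map f = (ν.map f Set.univ)⁻¹ • ν.map f := by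
  rw [Measure.map_smul, Measure.map_apply hf .univ, Set.preimage_univ]

end Measure

section NormalInverseWishart

variable {k : ℕ}

lemma isOpen_posDef_params :
    IsOpen {θ : (Fin k → ℝ) × SymCoord k | (symMatrix θ.2).PosDef} :=
  isOpen_posDef_symMatrix.preimage continuous_snd

lemma ae_posDef_paramMeasure : ∀ᵐ θ ∂paramMeasure k, (symMatrix θ.2).PosDef :=
  ae_restrict_mem isOpen_posDef_params.measurableSet

lemma paramMeasure_ne_zero : paramMeasure k ≠ 0 := by
  rw [paramMeasure, Ne, Measure.restrict_eq_zero]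
  refine (isOpen_posDef_params.measure_pos _ ⟨(0, symCoord 1), ?_⟩).ne'
  rw [Set.mem_ofPred_eq, symMatrix_symCoord Matrix.transpose_one]
  exact Matrix.PosDef.one

lemma measurable_niwExponent (κ : ℝ) (m : Fin k → ℝ) (S : Matrix (Fin k) (Fin k) ℝ) :
    Measurable fun θ : (Fin k → ℝ) × SymCoord k => niwExponent κ m S θ.1 (symMatrix θ.2) := by
  have hinv (i j : Fin k) : Measurable fun θ : (Fin k → ℝ) × SymCoord k => (symMatrix θ.2)⁻¹ i j :=
    (measurable_inv_symMatrix_apply i j).comp measurable_snd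
  have hsub (i : Fin k) : Measurable fun θ : (Fin k → ℝ) × SymCoord k => θ.1 i - m i :=
    ((measurable_pi_apply i).comp measurable_fst).sub_const _
  simp only [niwExponent, dotProduct, Matrix.mulVec, Pi.sub_apply, Matrix.trace, Matrix.diag,
    Matrix.mul_apply]
  refine (Measurable.const_mul ?_ κ).add ?_
  · exact Finset.measurable_fun_sum _ fun i _ => (hsub i).mul
      (Finset.measurable_fun_sum _ fun j _ => (hinv i j).mul (hsub j))
  · exact Finset.measurable_fun_sum _ fun i _ => Finset.measurable_fun_sum _ fun j _ =>
      (hinv i j).mul_const _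

lemma measurable_niwDensity (κ : ℝ) (m : Fin k → ℝ) (S : Matrix (Fin k) (Fin k) ℝ) (d : ℝ) :
    Measurable fun θ : (Fin k → ℝ) × SymCoord k => niwDensity κ m S d θ.1 (symMatrix θ.2) :=
  ((measurable_det_symMatrix.comp measurable_snd).pow_const _).mul
    ((measurable_niwExponent κ m S).neg.div_const 2).exp

/-- The measure with density `niwDensity` on the space of parameters. -/
noncomputable def niwMeasure (κ : ℝ) (m : Fin k → ℝ) (S : Matrix (Fin k) (Fin k) ℝ) (d : ℝ) :
    Measure ((Fin k → ℝ) × SymCoord k) :=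
  (paramMeasure k).withDensity fun θ => ENNReal.ofReal (niwDensity κ m S d θ.1 (symMatrix θ.2))

/-- The normal-inverse-Wishart distribution, in the parametrization of `niwDensity`. It is the zero
measure when the density is not integrable. -/
noncomputable def niwDistribution (κ : ℝ) (m : Fin k → ℝ) (S : Matrix (Fin k) (Fin k) ℝ) (d : ℝ) :
    Measure ((Fin k → ℝ) × SymCoord k) :=
  (niwMeasure κ m S d Set.univ)⁻¹ • niwMeasure κ m S d

instance niwMeasure_neZero (κ : ℝ) (m : Fin k → ℝ) (S : Matrix (Fin k) (Fin k) ℝ) (d : ℝ) :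
    NeZero (niwMeasure κ m S d) := by
  refine ⟨fun h => paramMeasure_ne_zero (k := k) ?_⟩
  rw [niwMeasure,
    withDensity_eq_zero_iff (measurable_niwDensity κ m S d).ennreal_ofReal.aemeasurable] at h
  refine ae_eq_bot.1 (Filter.eventually_false_iff_eq_bot.1 ?_)
  filter_upwards [h, ae_posDef_paramMeasure] with θ hθ hpos
  exact (niwDensity_pos κ m S d θ.1 hpos).not_ge (ENNReal.ofReal_eq_zero.1 hθ)

/-- The affine change of parameters `(μ, Σ) ↦ (a + A μ, A Σ Aᵀ)`. -/
noncomputable def paramMap (A : Matrix (Fin k) (Fin k) ℝ) (a : Fin k → ℝ)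
    (θ : (Fin k → ℝ) × SymCoord k) : (Fin k → ℝ) × SymCoord k :=
  (a + A *ᵥ θ.1, symConj A θ.2)

variable {A : Matrix (Fin k) (Fin k) ℝ}

lemma paramMap_eq_comp (A : Matrix (Fin k) (Fin k) ℝ) (a : Fin k → ℝ) :
    paramMap A a = (fun θ => ((a, 0) : (Fin k → ℝ) × SymCoord k) + θ) ∘
      (Matrix.toLin' A).prodMap (symConj A) := by
  ext1 θ
  simp [paramMap]

lemma measurable_paramMap (A : Matrix (Fin k) (Fin k) ℝ) (a : Fin k → ℝ) :
    Measurable (paramMap A a) := by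
  rw [paramMap_eq_comp]
  exact (measurable_const_add _).comp (LinearMap.continuous_of_finiteDimensional _).measurable

lemma map_paramMap_volume (hA : A.det ≠ 0) (a : Fin k → ℝ) :
    (volume : Measure ((Fin k → ℝ) × SymCoord k)).map (paramMap A a) =
      ENNReal.ofReal |(A.det * LinearMap.det (symConj A))⁻¹| • volume := by
  have hdet : LinearMap.det ((Matrix.toLin' A).prodMap (symConj A)) =
      A.det * LinearMap.det (symConj A) := by
    rw [LinearMap.det_prodMap, LinearMap.det_toLin']
  have : (volume : Measure ((Fin k → ℝ) × SymCoord k)).IsAddHaarMeasure :=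
    Measure.prod.instIsAddHaarMeasure (volume : Measure (Fin k → ℝ))
      (volume : Measure (SymCoord k))
  rw [paramMap_eq_comp, ← Measure.map_map (measurable_const_add _)
    (LinearMap.continuous_of_finiteDimensional _).measurable,
    Measure.map_linearMap_addHaar_eq_smul_addHaar _
      (by rw [hdet]; exact mul_ne_zero hA (det_symConj_ne_zero hA)),
    Measure.map_smul, map_add_left_eq_self, hdet]

lemma map_paramMap_paramMeasure (hA : A.det ≠ 0) (a : Fin k → ℝ) :
    (paramMeasure k).map (paramMap A a) =
      ENNReal.ofReal |(A.det * LinearMap.det (symConj A))⁻¹| • paramMeasure k := by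
  have hpre : {θ | (symMatrix θ.2).PosDef} =
      paramMap A a ⁻¹' {θ | (symMatrix θ.2).PosDef} := by
    ext θ
    simp only [Set.mem_ofPred_eq, Set.mem_preimage, paramMap, symMatrix_symConj,
      posDef_mul_mul_transpose_iff hA]
  rw [paramMeasure, hpre, ← Measure.restrict_map (measurable_paramMap A a)
    isOpen_posDef_params.measurableSet, map_paramMap_volume hA, Measure.restrict_smul, ← hpre]

lemma map_paramMap_niwMeasure (hA : A.det ≠ 0) (a : Fin k → ℝ) (κ : ℝ) (m : Fin k → ℝ)
    (S : Matrix (Fin k) (Fin k) ℝ) (d : ℝ) :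
    (niwMeasure κ m S d).map (paramMap A a) =
      ENNReal.ofReal (|A.det| ^ (d + 1) * |(A.det * LinearMap.det (symConj A))⁻¹|) •
        niwMeasure κ (a + A *ᵥ m) (A * S * Aᵀ) d := by
  set f : (Fin k → ℝ) × SymCoord k → ENNReal := fun θ =>
    .ofReal (niwDensity κ (a + A *ᵥ m) (A * S * Aᵀ) d θ.1 (symMatrix θ.2))
  have hf : Measurable f := (measurable_niwDensity _ _ _ _).ennreal_ofReal
  have hdensity : niwMeasure κ m S d =
      ENNReal.ofReal (|A.det| ^ (d + 1)) • (paramMeasure k).withDensity (f ∘ paramMap A a) := by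
    rw [← withDensity_smul _ (hf.comp (measurable_paramMap A a))]
    refine withDensity_congr_ae ?_
    filter_upwards [ae_posDef_paramMeasure] with θ hθ
    rw [niwDensity_congruence hA a κ m S d θ.1 hθ.det_pos.le, ENNReal.ofReal_mul (by positivity),
      ← symMatrix_symConj]
    rfl
  rw [hdensity, Measure.map_smul, map_withDensity_comp _ (measurable_paramMap A a) hf,
    map_paramMap_paramMeasure hA, withDensity_smul_measure, smul_smul,
    ← ENNReal.ofReal_mul (by positivity)]
  rfl

lemma map_paramMap_niwDistribution (hA : A.det ≠ 0) (a : Fin k → ℝ) (κ : ℝ) (m : Fin k → ℝ)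
    (S : Matrix (Fin k) (Fin k) ℝ) (d : ℝ) :
    (niwDistribution κ m S d).map (paramMap A a) =
      niwDistribution κ (a + A *ᵥ m) (A * S * Aᵀ) d := by
  have hjac : 0 < |A.det| ^ (d + 1) * |(A.det * LinearMap.det (symConj A))⁻¹| := by
    have := det_symConj_ne_zero hA
    positivity
  rw [niwDistribution, map_inv_univ_smul _ (measurable_paramMap A a), map_paramMap_niwMeasure hA,
    inv_univ_smul_smul (ENNReal.ofReal_pos.2 hjac).ne' ENNReal.ofReal_ne_top]
  rfl

lemma niwMeasure_one_univ (κ d : ℝ) {t : ℝ} (ht : 0 < t) :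
    niwMeasure κ (0 : Fin k → ℝ) 1 d Set.univ =
      ENNReal.ofReal (t ^ ((k : ℝ) * (d - k - 1) / 2)) *
        niwMeasure κ (0 : Fin k → ℝ) (t • 1) d Set.univ := by
  set A := √t • (1 : Matrix (Fin k) (Fin k) ℝ)
  have hdet : A.det = t ^ ((k : ℝ) / 2) := by
    rw [Matrix.det_smul, Matrix.det_one, mul_one, Fintype.card_fin, Real.sqrt_eq_rpow,
      ← Real.rpow_natCast, ← Real.rpow_mul ht.le]
    ring_nf
  have hdet_pos : 0 < A.det := hdet ▸ by positivity
  have hAA : A * 1 * Aᵀ = t • 1 := by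
    rw [mul_one, Matrix.transpose_smul, Matrix.transpose_one, smul_mul_smul_comm, mul_one,
      Real.mul_self_sqrt ht.le]
  have hjac : |A.det| ^ (d + 1) * |(A.det * LinearMap.det (symConj A))⁻¹| =
      t ^ ((k : ℝ) * (d - k - 1) / 2) := by
    rw [det_symConj_sqrt_smul_one ht, hdet, abs_of_pos (by positivity), abs_of_pos (by positivity),
      ← Real.rpow_mul ht.le, ← Real.rpow_add ht, ← Real.rpow_neg ht.le, ← Real.rpow_add ht]
    ring_nf
  have hmap := map_paramMap_niwMeasure hdet_pos.ne' 0 κ 0 1 d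
  rw [hAA, hjac, Matrix.mulVec_zero, add_zero] at hmap
  rw [← smul_eq_mul, ← Measure.smul_apply, ← hmap,
    Measure.map_apply (measurable_paramMap A 0) .univ, Set.preimage_univ]

end NormalInverseWishart

/-! ### The Gaussian integral of a quadratic form -/

section Gaussian

variable {ι : Type*} [Fintype ι] [DecidableEq ι]

open scoped MatrixOrder Matrix.Norms.L2Operator in
lemma exists_eq_mul_transpose_of_posDef {P : Matrix ι ι ℝ} (hP : P.PosDef) :
    ∃ A : Matrix ι ι ℝ, A.det ≠ 0 ∧ P = A * Aᵀ := by
  obtain ⟨B, hB⟩ := CStarAlgebra.nonneg_iff_eq_star_mul_self.mp hP.posSemidef.nonneg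
  rw [Matrix.star_eq_conjTranspose, Matrix.conjTranspose_eq_transpose_of_trivial] at hB
  refine ⟨Bᵀ, fun h => hP.det_pos.ne' ?_, by rw [Matrix.transpose_transpose, hB]⟩
  rw [hB, Matrix.det_mul, h, zero_mul]

lemma lintegral_comp_mulVec {A : Matrix ι ι ℝ} (hA : A.det ≠ 0) (f : (ι → ℝ) → ENNReal) :
    ∫⁻ v, f (A *ᵥ v) = ENNReal.ofReal |A.det⁻¹| * ∫⁻ v, f v := by
  have hemb : MeasurableEmbedding (Matrix.toLin' A) :=
    (LinearMap.continuous_of_finiteDimensional _).measurableEmbedding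
      (Matrix.mulVec_injective_of_isUnit ((Matrix.isUnit_iff_isUnit_det A).2 hA.isUnit))
  rw [← smul_eq_mul, ← lintegral_smul_measure, ← Real.map_matrix_volume_pi_eq_smul_volume_pi hA,
    hemb.lintegral_map]
  rfl

omit [DecidableEq ι] in
lemma lintegral_exp_neg_dotProduct_self :
    ∫⁻ v : ι → ℝ, ENNReal.ofReal (Real.exp (-(v ⬝ᵥ v) / 2)) =
      ENNReal.ofReal ((2 * Real.pi) ^ ((Fintype.card ι : ℝ) / 2)) := by
  have hprod (v : ι → ℝ) : Real.exp (-(v ⬝ᵥ v) / 2) = ∏ i, Real.exp (-(1 / 2) * v i ^ 2) := by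
    rw [← Real.exp_sum, dotProduct, ← Finset.mul_sum]
    simp only [sq]
    ring_nf
  have hint : Integrable fun v : ι → ℝ => ∏ i, Real.exp (-(1 / 2) * v i ^ 2) :=
    .fintype_prod (f := fun _ x => Real.exp (-(1 / 2) * x ^ 2)) fun _ =>
      integrable_exp_neg_mul_sq (by norm_num)
  simp only [hprod]
  rw [← ofReal_integral_eq_lintegral_ofReal hint
      (.of_forall fun v => Finset.prod_nonneg fun i _ => (Real.exp_pos _).le),
    integral_fintype_prod_volume_eq_pow fun x => Real.exp (-(1 / 2) * x ^ 2),
    integral_gaussian, Real.sqrt_eq_rpow, ← Real.rpow_natCast, ← Real.rpow_mul (by positivity)]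
  ring_nf

lemma lintegral_exp_neg_dotProduct_mulVec {P : Matrix ι ι ℝ} (hP : P.PosDef) :
    ∫⁻ v : ι → ℝ, ENNReal.ofReal (Real.exp (-(v ⬝ᵥ P *ᵥ v) / 2)) =
      ENNReal.ofReal (P.det ^ (-(1 : ℝ) / 2) * (2 * Real.pi) ^ ((Fintype.card ι : ℝ) / 2)) := by
  obtain ⟨A, hA, rfl⟩ := exists_eq_mul_transpose_of_posDef hP
  have hdet : (A * Aᵀ).det ^ (-(1 : ℝ) / 2) = |Aᵀ.det⁻¹| := by
    rw [Matrix.det_mul, Matrix.det_transpose, ← sq, ← sq_abs, ← Real.rpow_natCast,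
      ← Real.rpow_mul (abs_nonneg _), abs_inv, ← Real.rpow_neg_one]
    norm_num
  rw [hdet, ENNReal.ofReal_mul (abs_nonneg _), ← lintegral_exp_neg_dotProduct_self,
    ← lintegral_comp_mulVec (by rwa [Matrix.det_transpose])]
  simp only [← Matrix.mulVec_mulVec, Matrix.dotProduct_mulVec, ← Matrix.mulVec_transpose]

end Gaussian

/-! ### Bordered matrices -/

section Bordered

variable {ι : Type*} [Fintype ι] [DecidableEq ι]

/-- The matrix `S` bordered by the row and column `(b, a)`. -/
def bordered {R : Type*} (S : Matrix ι ι R) (b : ι → R) (a : R) : Matrix (ι ⊕ Unit) (ι ⊕ Unit) R :=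
  Matrix.fromBlocks S (Matrix.replicateCol Unit b) (Matrix.replicateRow Unit b)
    (Matrix.of fun _ _ => a)

variable {K : Type*} [Field K] {S : Matrix ι ι K}

lemma schurComplement_bordered (hS : IsUnit S.det) (β : ι → K) (q : K) :
    (Matrix.of fun _ _ : Unit => q + β ⬝ᵥ S *ᵥ β) -
      Matrix.replicateRow Unit (S *ᵥ β) * S⁻¹ * Matrix.replicateCol Unit (S *ᵥ β) =
      Matrix.of fun _ _ => q := by
  rw [Matrix.mul_assoc, ← Matrix.replicateCol_mulVec, Matrix.mulVec_mulVec,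
    Matrix.nonsing_inv_mul _ hS, Matrix.one_mulVec]
  ext
  simp [Matrix.mul_apply, dotProduct, mul_comm]

lemma det_bordered_mulVec (hS : IsUnit S.det) (β : ι → K) (q : K) :
    (bordered S (S *ᵥ β) (q + β ⬝ᵥ S *ᵥ β)).det = S.det * q := by
  have := S.invertibleOfIsUnitDet hS
  rw [bordered, Matrix.det_fromBlocks₁₁, Matrix.invOf_eq_nonsing_inv, schurComplement_bordered hS,
    Matrix.det_unique (n := Unit), Matrix.of_apply]

lemma trace_inv_bordered_mulVec (hS : IsUnit S.det) (hST : S.IsSymm) (β : ι → K) {q : K}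
    (hq : q ≠ 0) :
    (bordered S (S *ᵥ β) (q + β ⬝ᵥ S *ᵥ β))⁻¹.trace = S⁻¹.trace + (1 + β ⬝ᵥ β) / q := by
  have hβ : S⁻¹ *ᵥ S *ᵥ β = β := by
    rw [Matrix.mulVec_mulVec, Matrix.nonsing_inv_mul _ hS, Matrix.one_mulVec]
  have hcol : S⁻¹ * Matrix.replicateCol Unit (S *ᵥ β) = Matrix.replicateCol Unit β := by
    rw [← Matrix.replicateCol_mulVec, hβ]
  have hrow : Matrix.replicateRow Unit (S *ᵥ β) * S⁻¹ = Matrix.replicateRow Unit β := by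
    rw [← Matrix.replicateRow_vecMul, ← Matrix.mulVec_transpose, Matrix.transpose_nonsing_inv,
      hST.eq, hβ]
  have hq_inv : (Matrix.of fun _ _ : Unit => q)⁻¹ = Matrix.of fun _ _ => q⁻¹ := by
    ext
    simp
  have hschur := schurComplement_bordered hS β q
  have hunit := det_bordered_mulVec hS β q ▸ hS.mul hq.isUnit
  rw [bordered] at hunit ⊢
  have := S.invertibleOfIsUnitDet hS
  have := Matrix.invertibleOfIsUnitDet _ hunit
  rw [← Matrix.invOf_eq_nonsing_inv S] at hschur
  have : Invertible ((Matrix.of fun _ _ : Unit => q + β ⬝ᵥ S *ᵥ β) -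
      Matrix.replicateRow Unit (S *ᵥ β) * ⅟S * Matrix.replicateCol Unit (S *ᵥ β)) :=
    Matrix.invertibleOfIsUnitDet _ (by rw [hschur]; simpa using hq)
  rw [← Matrix.invOf_eq_nonsing_inv, Matrix.invOf_fromBlocks₁₁_eq]
  simp only [Matrix.invOf_eq_nonsing_inv] at hschur ⊢
  rw [hschur, hq_inv, hcol, Matrix.mul_assoc _ _ S⁻¹, hrow]
  simp only [Matrix.trace, Matrix.diag, Fintype.sum_sum_type, Matrix.fromBlocks_apply₁₁,
    Matrix.fromBlocks_apply₂₂, Matrix.add_apply, Finset.sum_add_distrib]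
  simp only [Matrix.mul_apply, dotProduct]
  simp only [Finset.univ_unique, PUnit.default_eq_unit, Matrix.replicateCol_apply,
    Matrix.of_apply, Finset.sum_const, Finset.card_singleton, one_smul, Matrix.replicateRow_apply,
    add_assoc, add_comm (1 : K), div_eq_mul_inv, mul_right_comm]
  rw [add_mul, one_mul, Finset.sum_mul]

end Bordered

section Split

/-- The positions on and above the diagonal of a matrix of size `k + 1`: those of its lower right
block, the rest of its first row, and the corner. -/
def borderedIndex (k : ℕ) : ({p : Fin k × Fin k // p.1 ≤ p.2} ⊕ Fin k) ⊕ Unit →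
    {p : Fin (k + 1) × Fin (k + 1) // p.1 ≤ p.2} :=
  Sum.elim (Sum.elim (fun p => ⟨(p.1.1.succ, p.1.2.succ), Fin.succ_le_succ_iff.2 p.2⟩)
    fun i => ⟨(0, i.succ), Fin.zero_le _⟩) fun _ => ⟨(0, 0), le_rfl⟩

lemma borderedIndex_bijective (k : ℕ) : Function.Bijective (borderedIndex k) := by
  refine ⟨?_, fun ⟨⟨i, j⟩, h⟩ => ?_⟩
  · rintro ((⟨⟨i, j⟩, h⟩ | i) | _) ((⟨⟨i', j'⟩, h'⟩ | i') | _) <;>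
      simp [borderedIndex, (Fin.succ_ne_zero _).symm]
  · cases i using Fin.cases <;> cases j using Fin.cases
    case zero.zero => exact ⟨.inr (), rfl⟩
    case zero.succ j => exact ⟨.inl (.inr j), rfl⟩
    case succ.zero i => simp at h
    case succ.succ i j => exact ⟨.inl (.inl ⟨(i, j), Fin.succ_le_succ_iff.1 h⟩), rfl⟩

/-- The splitting of a symmetric matrix into its lower right block, the rest of its first row and
its corner. -/
noncomputable def symSplit (k : ℕ) : SymCoord (k + 1) ≃ᵐ (SymCoord k × (Fin k → ℝ)) × ℝ :=
  (MeasurableEquiv.piCongrLeft (fun _ => ℝ)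
    (Equiv.ofBijective _ (borderedIndex_bijective k))).symm.trans <|
    (MeasurableEquiv.sumPiEquivProdPi fun _ => ℝ).trans <|
      (MeasurableEquiv.sumPiEquivProdPi fun _ => ℝ).prodCongr (MeasurableEquiv.funUnique Unit ℝ)

lemma measurePreserving_symSplit (k : ℕ) : MeasurePreserving (symSplit k) :=
  (volume_measurePreserving_piCongrLeft (fun _ => ℝ)
    (Equiv.ofBijective _ (borderedIndex_bijective k))).symm.trans <|
    (volume_measurePreserving_sumPiEquivProdPi fun _ => ℝ).trans <|
      (volume_measurePreserving_sumPiEquivProdPi fun _ => ℝ).prod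
        (volume_preserving_funUnique Unit ℝ)

lemma symSplit_apply {k : ℕ} (s : SymCoord (k + 1)) :
    symSplit k s = ((fun p => s (borderedIndex k (.inl (.inl p))),
      fun i => s (borderedIndex k (.inl (.inr i)))), s (borderedIndex k (.inr ()))) := rfl

lemma symMatrix_eq_submatrix_bordered {k : ℕ} (s : SymCoord (k + 1)) :
    symMatrix s = (bordered (symMatrix (symSplit k s).1.1) (symSplit k s).1.2
      (symSplit k s).2).submatrix ((finSuccEquiv k).trans (Equiv.optionEquivSumPUnit _))
        ((finSuccEquiv k).trans (Equiv.optionEquivSumPUnit _)) := by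
  ext i j
  cases i using Fin.cases <;> cases j using Fin.cases <;>
    simp [bordered, symMatrix_apply, symSplit_apply, borderedIndex,
      ← Fin.strictMono_succ.monotone.map_min, ← Fin.strictMono_succ.monotone.map_max]

lemma lintegral_symMatrix_succ_le {k : ℕ} {f : Matrix (Fin (k + 1)) (Fin (k + 1)) ℝ → ENNReal}
    {g : Matrix (Fin k ⊕ Unit) (Fin k ⊕ Unit) ℝ → ENNReal}
    (hfg : ∀ M (e : Fin (k + 1) ≃ Fin k ⊕ Unit), f (M.submatrix e e) = g M) :
    ∫⁻ s, f (symMatrix s) ≤ ∫⁻ s, ∫⁻ b, ∫⁻ a, g (bordered (symMatrix s) b a) := by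
  simp only [symMatrix_eq_submatrix_bordered, hfg]
  rw [(measurePreserving_symSplit k).lintegral_comp_emb (symSplit k).measurableEmbedding
    fun p => g (bordered (symMatrix p.1.1) p.1.2 p.2)]
  exact (lintegral_prod_le _).trans (lintegral_prod_le _)

end Split

section Gamma

lemma integrableOn_rpow_neg_mul_exp_neg_div {a b : ℝ} (ha : 1 < a) (hb : 0 < b) :
    IntegrableOn (fun q : ℝ => q ^ (-a) * Real.exp (-(b / q))) (Set.Ioi 0) := by
  have hgamma := (integrableOn_Ioi_comp_rpow_iff' _ (by norm_num : (-1 : ℝ) ≠ 0)).2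
    (integrableOn_rpow_mul_exp_neg_mul_rpow (by linarith : -1 < a - 2) one_pos hb)
  refine hgamma.congr_fun (fun q (hq : 0 < q) => ?_) measurableSet_Ioi
  beta_reduce
  rw [smul_eq_mul, ← Real.rpow_mul hq.le, ← mul_assoc, ← Real.rpow_add hq, Real.rpow_one,
    Real.rpow_neg_one, neg_mul, div_eq_mul_inv]
  ring_nf

end Gamma

section Finiteness

variable {ι : Type*} [Fintype ι] [DecidableEq ι]

open scoped Classical in
/-- The kernel `|M| ^ (-d/2) exp (-tr M⁻¹ / 2)` of the inverse Wishart distribution `IW (d, 1)`, on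
positive definite matrices. -/
noncomputable def iwKernel (d : ℝ) (M : Matrix ι ι ℝ) : ENNReal :=
  if M.PosDef then ENNReal.ofReal (M.det ^ (-d / 2) * Real.exp (-M⁻¹.trace / 2)) else 0

lemma iwKernel_submatrix_equiv {ι' : Type*} [Fintype ι'] [DecidableEq ι'] (d : ℝ)
    (M : Matrix ι ι ℝ) (e : ι' ≃ ι) : iwKernel d (M.submatrix e e) = iwKernel d M := by
  have htrace (N : Matrix ι ι ℝ) : (N.submatrix e e).trace = N.trace :=
    e.sum_comp fun i => N i i
  have hpos : (M.submatrix e e).PosDef ↔ M.PosDef :=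
    ⟨fun h => by simpa using h.submatrix e.symm.injective, fun h => h.submatrix e.injective⟩
  rw [iwKernel, iwKernel, Matrix.det_submatrix_equiv_self, Matrix.inv_submatrix_equiv, htrace]
  classical exact if_congr hpos rfl rfl

lemma iwKernel_sub_two (d : ℝ) {M : Matrix ι ι ℝ} (hM : M.PosDef) :
    iwKernel (d - 2) M = ENNReal.ofReal M.det * iwKernel d M := by
  rw [iwKernel, iwKernel, if_pos hM, if_pos hM, ← ENNReal.ofReal_mul hM.det_pos.le, ← mul_assoc,
    show -(d - 2) / 2 = 1 + -d / 2 by ring, Real.rpow_add hM.det_pos, Real.rpow_one]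

/-- The factor contributed to `iwKernel` by a border `(S β, q + βᵀ S β)`. -/
noncomputable def borderKernel (d : ℝ) (β : ι → ℝ) (q : ℝ) : ℝ :=
  q ^ (-d / 2) * Real.exp (-((1 + β ⬝ᵥ β) / q) / 2)

lemma iwKernel_bordered_mulVec_le (d : ℝ) {S : Matrix ι ι ℝ} (hS : S.PosDef) (β : ι → ℝ) (q : ℝ) :
    iwKernel d (bordered S (S *ᵥ β) (q + β ⬝ᵥ S *ᵥ β)) ≤
      iwKernel d S * (Set.Ioi 0).indicator (fun q => ENNReal.ofReal (borderKernel d β q)) q := by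
  by_cases hB : (bordered S (S *ᵥ β) (q + β ⬝ᵥ S *ᵥ β)).PosDef
  · have hSdet := hS.det_pos
    have hdet := det_bordered_mulVec hSdet.ne'.isUnit β q
    have hq : 0 < q := pos_of_mul_pos_right (hdet ▸ hB.det_pos) hSdet.le
    rw [Set.indicator_of_mem (Set.mem_Ioi.2 hq), iwKernel, iwKernel, if_pos hB, if_pos hS, hdet,
      trace_inv_bordered_mulVec hSdet.ne'.isUnit (Matrix.isHermitian_iff_isSymm.1 hS.isHermitian) β
        hq.ne', ← ENNReal.ofReal_mul (by positivity), borderKernel, mul_mul_mul_comm,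
      Real.mul_rpow hSdet.le hq.le, ← Real.exp_add]
    ring_nf
    rfl
  · rw [iwKernel, if_neg hB]
    exact zero_le

lemma lintegral_iwKernel_bordered_le (d : ℝ) (S : Matrix ι ι ℝ) :
    ∫⁻ b : ι → ℝ, ∫⁻ a, iwKernel d (bordered S b a) ≤
      iwKernel (d - 2) S *
        ∫⁻ β : ι → ℝ, ∫⁻ q in Set.Ioi 0, ENNReal.ofReal (borderKernel d β q) := by
  by_cases hS : S.PosDef
  swap
  · have (b : ι → ℝ) (a : ℝ) : iwKernel d (bordered S b a) = 0 :=
      if_neg fun hB => hS (hB.submatrix Sum.inl_injective)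
    simp [this]
  have hSdet := hS.det_pos
  calc ∫⁻ b : ι → ℝ, ∫⁻ a, iwKernel d (bordered S b a)
    _ = ENNReal.ofReal S.det * ∫⁻ β : ι → ℝ, ∫⁻ a, iwKernel d (bordered S (S *ᵥ β) a) := by
      rw [lintegral_comp_mulVec hSdet.ne' fun b => ∫⁻ a, iwKernel d (bordered S b a), ← mul_assoc,
        ← ENNReal.ofReal_mul hSdet.le, abs_of_pos (inv_pos.2 hSdet), mul_inv_cancel₀ hSdet.ne',
        ENNReal.ofReal_one, one_mul]
    _ = ENNReal.ofReal S.det *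
        ∫⁻ β : ι → ℝ, ∫⁻ q, iwKernel d (bordered S (S *ᵥ β) (q + β ⬝ᵥ S *ᵥ β)) := by
      congr 2 with β
      exact (lintegral_add_right_eq_self _ _).symm
    _ ≤ ENNReal.ofReal S.det * ∫⁻ β : ι → ℝ, ∫⁻ q, iwKernel d S *
        (Set.Ioi 0).indicator (fun q => ENNReal.ofReal (borderKernel d β q)) q := by
      gcongr
      exact iwKernel_bordered_mulVec_le d hS _ _
    _ = _ := by
      have hfin : iwKernel d S ≠ ⊤ := by simp [iwKernel, hS]
      simp only [lintegral_const_mul' _ _ hfin, lintegral_indicator measurableSet_Ioi,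
        iwKernel_sub_two d hS, mul_assoc]

omit [DecidableEq ι] in
lemma lintegral_borderKernel_lt_top {d : ℝ} (hd : Fintype.card ι + 2 < d) :
    ∫⁻ β : ι → ℝ, ∫⁻ q in Set.Ioi 0, ENNReal.ofReal (borderKernel d β q) < ⊤ := by
  classical
  have hgauss {q : ℝ} (hq : 0 < q) :
      ∫⁻ β : ι → ℝ, ENNReal.ofReal (borderKernel d β q) =
        ENNReal.ofReal ((2 * Real.pi) ^ ((Fintype.card ι : ℝ) / 2) *
          (q ^ (-((d - Fintype.card ι) / 2)) * Real.exp (-(1 / 2 / q)))) := by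
    have hsplit (β : ι → ℝ) : borderKernel d β q = q ^ (-d / 2) * Real.exp (-(1 / 2 / q)) *
        Real.exp (-(β ⬝ᵥ (q⁻¹ • (1 : Matrix ι ι ℝ)) *ᵥ β) / 2) := by
      rw [borderKernel, mul_assoc, ← Real.exp_add, Matrix.smul_mulVec, Matrix.one_mulVec,
        dotProduct_smul, smul_eq_mul]
      ring_nf
    simp only [hsplit, ENNReal.ofReal_mul (show 0 ≤ q ^ (-d / 2) * Real.exp (-(1 / 2 / q)) by
      positivity)]
    rw [lintegral_const_mul' _ _ ENNReal.ofReal_ne_top,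
      lintegral_exp_neg_dotProduct_mulVec (Matrix.PosDef.one.smul (inv_pos.2 hq)),
      ← ENNReal.ofReal_mul (by positivity), Matrix.det_smul, Matrix.det_one, mul_one,
      ← Real.rpow_natCast, ← Real.rpow_mul (by positivity), Real.inv_rpow hq.le,
      ← Real.rpow_neg hq.le,
      show -((d - Fintype.card ι) / 2) = -d / 2 + -((Fintype.card ι : ℝ) * (-1 / 2)) by ring,
      Real.rpow_add hq]
    congr 1
    ring
  have hint := (integrableOn_rpow_neg_mul_exp_neg_div
    (by linarith : 1 < (d - Fintype.card ι) / 2) one_half_pos).const_mul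
      ((2 * Real.pi) ^ ((Fintype.card ι : ℝ) / 2))
  rw [lintegral_lintegral_swap
      (by unfold Function.uncurry borderKernel; simp only [dotProduct]; fun_prop),
    setLIntegral_congr_fun measurableSet_Ioi fun q hq => hgauss hq]
  exact hint.lintegral_lt_top

lemma lintegral_iwKernel_symMatrix_lt_top {k : ℕ} {d : ℝ} (hd : 2 * k < d) :
    ∫⁻ s : SymCoord k, iwKernel d (symMatrix s) < ⊤ := by
  induction k generalizing d with
  | zero =>
    have hone (s : SymCoord 0) : iwKernel d (symMatrix s) = ENNReal.ofReal (Real.exp 0) := by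
      rw [Subsingleton.elim (symMatrix s) 1, iwKernel, if_pos Matrix.PosDef.one]
      simp
    simp [hone]
  | succ k ih =>
    push_cast at hd
    calc ∫⁻ s : SymCoord (k + 1), iwKernel d (symMatrix s)
      _ ≤ ∫⁻ s, ∫⁻ b, ∫⁻ a, iwKernel d (bordered (symMatrix s) b a) :=
        lintegral_symMatrix_succ_le fun M e => iwKernel_submatrix_equiv d M e
      _ ≤ ∫⁻ s : SymCoord k, iwKernel (d - 2) (symMatrix s) *
          ∫⁻ β : Fin k → ℝ, ∫⁻ q in Set.Ioi 0, ENNReal.ofReal (borderKernel d β q) :=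
        lintegral_mono fun s => lintegral_iwKernel_bordered_le d _
      _ < ⊤ := by
        have hborder := lintegral_borderKernel_lt_top (ι := Fin k) (d := d)
          (by rw [Fintype.card_fin]; linarith [(k.cast_nonneg : (0 : ℝ) ≤ k)])
        rw [lintegral_mul_const' _ _ hborder.ne]
        exact ENNReal.mul_lt_top (ih (by linarith)) hborder

lemma lintegral_niwDensity_zero_one {κ : ℝ} (hκ : 0 < κ) (d : ℝ) {Sig : Matrix ι ι ℝ}
    (hSig : Sig.PosDef) :
    ∫⁻ μ : ι → ℝ, ENNReal.ofReal (niwDensity κ 0 1 d μ Sig) =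
      ENNReal.ofReal ((2 * Real.pi / κ) ^ ((Fintype.card ι : ℝ) / 2)) * iwKernel d Sig := by
  have hsplit (μ : ι → ℝ) : niwDensity κ 0 1 d μ Sig = Sig.det ^ (-(d + 1) / 2) *
      Real.exp (-Sig⁻¹.trace / 2) * Real.exp (-(μ ⬝ᵥ (κ • Sig⁻¹) *ᵥ μ) / 2) := by
    rw [niwDensity, niwExponent, mul_assoc, ← Real.exp_add, sub_zero, mul_one, Matrix.smul_mulVec,
      dotProduct_smul, smul_eq_mul]
    ring_nf
  have hpos := hSig.det_pos
  simp only [hsplit, ENNReal.ofReal_mul (show 0 ≤ Sig.det ^ (-(d + 1) / 2) *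
      Real.exp (-Sig⁻¹.trace / 2) by positivity)]
  rw [lintegral_const_mul' _ _ ENNReal.ofReal_ne_top,
    lintegral_exp_neg_dotProduct_mulVec (hSig.inv.smul hκ), ← ENNReal.ofReal_mul (by positivity),
    iwKernel, if_pos hSig, ← ENNReal.ofReal_mul (by positivity), Matrix.det_smul,
    Matrix.det_nonsing_inv, Ring.inverse_eq_inv', Real.mul_rpow (by positivity) (by positivity),
    Real.inv_rpow hpos.le, ← Real.rpow_neg hpos.le, Real.div_rpow (by positivity) hκ.le,
    ← Real.rpow_natCast, ← Real.rpow_mul hκ.le, div_eq_mul_inv _ (κ ^ _), ← Real.rpow_neg hκ.le,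
    show -d / 2 = -(d + 1) / 2 + -(-(1 : ℝ) / 2) by ring, Real.rpow_add hpos]
  ring_nf

lemma niwMeasure_zero_one_univ_lt_top {k : ℕ} {κ d : ℝ} (hκ : 0 < κ) (hd : 2 * k < d) :
    niwMeasure κ (0 : Fin k → ℝ) 1 d Set.univ < ⊤ := by
  set f : (Fin k → ℝ) × SymCoord k → ENNReal := {θ | (symMatrix θ.2).PosDef}.indicator fun θ =>
    ENNReal.ofReal (niwDensity κ 0 1 d θ.1 (symMatrix θ.2))
  have hf : Measurable f :=
    (measurable_niwDensity _ _ _ _).ennreal_ofReal.indicator isOpen_posDef_params.measurableSet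
  have hfiber (s : SymCoord k) : ∫⁻ μ, f (μ, s) =
      ENNReal.ofReal ((2 * Real.pi / κ) ^ ((k : ℝ) / 2)) * iwKernel d (symMatrix s) := by
    by_cases hs : (symMatrix s).PosDef
    · simpa [f, Set.indicator, hs] using lintegral_niwDensity_zero_one hκ d hs
    · simp [f, hs, iwKernel]
  rw [niwMeasure, withDensity_apply _ .univ, setLIntegral_univ, paramMeasure,
    ← lintegral_indicator isOpen_posDef_params.measurableSet, Measure.volume_eq_prod,
    lintegral_prod_symm _ hf.aemeasurable]
  simp only [hfiber]
  rw [lintegral_const_mul' _ _ ENNReal.ofReal_ne_top]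
  exact ENNReal.mul_lt_top ENNReal.ofReal_lt_top (lintegral_iwKernel_symMatrix_lt_top hd)

lemma isProbabilityMeasure_niwDistribution {k : ℕ} {κ d : ℝ} (hκ : 0 < κ) (hd : 2 * k < d)
    (m : Fin k → ℝ) {S : Matrix (Fin k) (Fin k) ℝ} (hS : S.PosDef) :
    IsProbabilityMeasure (niwDistribution κ m S d) := by
  obtain ⟨A, hA, rfl⟩ := exists_eq_mul_transpose_of_posDef hS
  have : IsFiniteMeasure (niwMeasure κ (0 : Fin k → ℝ) 1 d) :=
    ⟨niwMeasure_zero_one_univ_lt_top hκ hd⟩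
  have : IsProbabilityMeasure (niwDistribution κ (0 : Fin k → ℝ) 1 d) := by
    unfold niwDistribution
    infer_instance
  have hmap := map_paramMap_niwDistribution hA m κ 0 1 d
  rw [Matrix.mulVec_zero, add_zero, mul_one] at hmap
  exact hmap ▸ Measure.isProbabilityMeasure_map (measurable_paramMap A m).aemeasurable

end Finiteness

/-! ### Moments of the normal-inverse-Wishart distribution -/

section EntryBounds

variable {ι : Type*} [Fintype ι] {P : Matrix ι ι ℝ}

lemma abs_dotProduct_mulVec_le (hP : P.PosSemidef) (u v : ι → ℝ) :
    |u ⬝ᵥ P *ᵥ v| ≤ (u ⬝ᵥ P *ᵥ u + v ⬝ᵥ P *ᵥ v) / 2 := by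
  have hcomm :=
    dotProduct_mulVec_comm_of_isSymm (Matrix.isHermitian_iff_isSymm.1 hP.isHermitian) v u
  have hadd := dotProduct_mulVec_nonneg_of_posSemidef hP (u + v)
  have hsub := dotProduct_mulVec_nonneg_of_posSemidef hP (u - v)
  simp only [Matrix.mulVec_add, Matrix.mulVec_sub, add_dotProduct, sub_dotProduct,
    dotProduct_add, dotProduct_sub, hcomm] at hadd hsub
  rw [abs_le]
  constructor <;> linarith

lemma diag_le_trace (hP : P.PosSemidef) (i : ι) : P i i ≤ P.trace :=
  Finset.single_le_sum (f := fun i => P i i) (fun _ _ => hP.diag_nonneg) (Finset.mem_univ i)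

lemma abs_apply_le_trace (hP : P.PosSemidef) (i j : ι) : |P i j| ≤ P.trace := by
  classical
  have h := abs_dotProduct_mulVec_le hP (Pi.single i 1) (Pi.single j 1)
  simp only [Matrix.mulVec_single_one, single_one_dotProduct, Matrix.col_apply] at h
  linarith [diag_le_trace hP i, diag_le_trace hP j]

lemma abs_mulVec_apply_le (hP : P.PosSemidef) (v : ι → ℝ) (i : ι) :
    |(P *ᵥ v) i| ≤ v ⬝ᵥ P *ᵥ v + P.trace := by
  classical
  have h := abs_dotProduct_mulVec_le hP (Pi.single i 1) v
  simp only [Matrix.mulVec_single_one, single_one_dotProduct, Matrix.col_apply] at h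
  linarith [diag_le_trace hP i, hP.trace_nonneg, dotProduct_mulVec_nonneg_of_posSemidef hP v]

end EntryBounds

section Moments

variable {k : ℕ} {κ d : ℝ}

lemma ae_posDef_niwDistribution (κ : ℝ) (m : Fin k → ℝ) (S : Matrix (Fin k) (Fin k) ℝ) (d : ℝ) :
    ∀ᵐ θ ∂niwDistribution κ m S d, (symMatrix θ.2).PosDef :=
  ((withDensity_absolutelyContinuous _ _).smul_left _).ae_le ae_posDef_paramMeasure

lemma lintegral_exp_mul_niwExponent (κ κ' : ℝ) (m : Fin k → ℝ) (S : Matrix (Fin k) (Fin k) ℝ)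
    (d u : ℝ) :
    ∫⁻ θ, ENNReal.ofReal (Real.exp (u * niwExponent κ' m S θ.1 (symMatrix θ.2)))
        ∂niwMeasure κ m S d =
      niwMeasure (κ - 2 * u * κ') m ((1 - 2 * u) • S) d Set.univ := by
  rw [niwMeasure, niwMeasure, withDensity_apply _ .univ, setLIntegral_univ,
    lintegral_withDensity_eq_lintegral_mul _ (measurable_niwDensity κ m S d).ennreal_ofReal
      ((measurable_niwExponent κ' m S).const_mul u).exp.ennreal_ofReal]
  refine lintegral_congr fun θ => ?_
  rw [Pi.mul_apply, ← ENNReal.ofReal_mul' (Real.exp_pos _).le, niwDensity_mul_exp_mul_niwExponent]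

lemma niwMeasure_zero_smul_one_univ_lt_top (hκ : 0 < κ) (hd : 2 * k < d) {t : ℝ} (ht : 0 < t) :
    niwMeasure κ (0 : Fin k → ℝ) (t • 1) d Set.univ < ⊤ := by
  have h := niwMeasure_zero_one_univ_lt_top (k := k) hκ hd
  rw [niwMeasure_one_univ κ d ht] at h
  exact ENNReal.lt_top_of_mul_ne_top_right h.ne (by positivity)

lemma integrable_exp_mul_niwExponent (hd : 2 * k < d) {κ' u : ℝ} (hu : u < 1 / 2)
    (hκ' : 2 * u * κ' < κ) :
    Integrable (fun θ => Real.exp (u * niwExponent κ' 0 1 θ.1 (symMatrix θ.2)))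
      (niwDistribution κ (0 : Fin k → ℝ) 1 d) := by
  refine Integrable.smul_measure ?_ (ENNReal.inv_ne_top.2 (NeZero.ne _))
  refine ⟨((measurable_niwExponent κ' 0 1).const_mul u).exp.aestronglyMeasurable, ?_⟩
  rw [hasFiniteIntegral_iff_ofReal (.of_forall fun θ => (Real.exp_pos _).le),
    lintegral_exp_mul_niwExponent]
  exact niwMeasure_zero_smul_one_univ_lt_top (by linarith) hd (by linarith)

lemma zero_mem_interior_integrableExpSet_niwExponent (hκ : 0 < κ) (hd : 2 * k < d) (κ' : ℝ) :
    0 ∈ interior (integrableExpSet (fun θ => niwExponent κ' 0 1 θ.1 (symMatrix θ.2))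
      (niwDistribution κ (0 : Fin k → ℝ) 1 d)) := by
  have hcont : Continuous fun u : ℝ => 2 * u * κ' := by fun_prop
  rw [mem_interior_iff_mem_nhds]
  filter_upwards [Iio_mem_nhds one_half_pos,
    hcont.continuousAt.eventually_lt_const (by simpa using hκ)] with u hu hκ'
  exact integrable_exp_mul_niwExponent hd hu hκ'

lemma integrable_niwExponent (hκ : 0 < κ) (hd : 2 * k < d) (κ' : ℝ) :
    Integrable (fun θ => niwExponent κ' 0 1 θ.1 (symMatrix θ.2))
      (niwDistribution κ (0 : Fin k → ℝ) 1 d) :=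
  integrable_of_mem_interior_integrableExpSet
    (zero_mem_interior_integrableExpSet_niwExponent hκ hd κ')

lemma niwExponent_zero_zero_one (μ : Fin k → ℝ) (Sig : Matrix (Fin k) (Fin k) ℝ) :
    niwExponent 0 0 1 μ Sig = Sig⁻¹.trace := by
  rw [niwExponent, zero_mul, zero_add, mul_one]

lemma mgf_trace_inv (hκ : 0 < κ) (hd : 2 * k < d) {u : ℝ} (hu : u < 1 / 2) :
    mgf (fun θ => (symMatrix θ.2)⁻¹.trace) (niwDistribution κ (0 : Fin k → ℝ) 1 d) u =
      (1 - 2 * u) ^ (-((k : ℝ) * (d - k - 1) / 2)) := by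
  have hu' : 0 < 1 - 2 * u := by linarith
  have hne : niwMeasure κ (0 : Fin k → ℝ) ((1 - 2 * u) • 1) d Set.univ ≠ 0 := NeZero.ne _
  have htop := (niwMeasure_zero_smul_one_univ_lt_top (k := k) hκ hd hu').ne
  have hpow : ENNReal.ofReal ((1 - 2 * u) ^ ((k : ℝ) * (d - k - 1) / 2)) ≠ 0 := by positivity
  have htrace : (fun θ : (Fin k → ℝ) × SymCoord k => (symMatrix θ.2)⁻¹.trace) =
      fun θ => niwExponent 0 0 1 θ.1 (symMatrix θ.2) :=
    funext fun θ => (niwExponent_zero_zero_one θ.1 _).symm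
  rw [htrace, mgf, integral_eq_lintegral_of_nonneg_ae (.of_forall fun θ => (Real.exp_pos _).le)
      ((measurable_niwExponent 0 0 1).const_mul u).exp.aestronglyMeasurable, niwDistribution,
    lintegral_smul_measure, lintegral_exp_mul_niwExponent, mul_zero, sub_zero,
    niwMeasure_one_univ κ d hu', smul_eq_mul, ENNReal.mul_inv (.inl hpow) (.inr hne), mul_assoc,
    ENNReal.inv_mul_cancel hne htop, mul_one, ENNReal.toReal_inv,
    ENNReal.toReal_ofReal (by positivity), Real.rpow_neg hu'.le]

lemma integral_trace_inv (hκ : 0 < κ) (hd : 2 * k < d) :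
    ∫ θ, (symMatrix θ.2)⁻¹.trace ∂niwDistribution κ (0 : Fin k → ℝ) 1 d = k * (d - k - 1) := by
  have hmem := zero_mem_interior_integrableExpSet_niwExponent (k := k) hκ hd 0
  simp only [niwExponent_zero_zero_one] at hmem
  have hmgf : mgf (fun θ => (symMatrix θ.2)⁻¹.trace) (niwDistribution κ (0 : Fin k → ℝ) 1 d)
      =ᶠ[nhds 0] fun u => (1 - 2 * u) ^ (-((k : ℝ) * (d - k - 1) / 2)) := by
    filter_upwards [Iio_mem_nhds one_half_pos] with u hu using mgf_trace_inv hκ hd hu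
  have hlin : HasDerivAt (fun u : ℝ => 1 - 2 * u) (-(2 * 1)) 0 :=
    ((hasDerivAt_id _).const_mul 2).const_sub 1
  rw [← deriv_mgf_zero hmem, hmgf.deriv_eq, (hlin.rpow_const (by simp)).deriv]
  simp only [mul_one, mul_neg, neg_mul, neg_neg, mul_zero, sub_zero, Real.one_rpow]
  ring

lemma measurable_inv_apply (i j : Fin k) :
    Measurable fun θ : (Fin k → ℝ) × SymCoord k => (symMatrix θ.2)⁻¹ i j :=
  (measurable_inv_symMatrix_apply i j).comp measurable_snd

lemma measurable_inv_mulVec {f : (Fin k → ℝ) × SymCoord k → Fin k → ℝ} (hf : Measurable f) :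
    Measurable fun θ => (symMatrix θ.2)⁻¹ *ᵥ f θ := by
  refine measurable_pi_lambda _ fun i => ?_
  simp only [Matrix.mulVec, dotProduct]
  exact Finset.measurable_fun_sum _ fun j _ =>
    (measurable_inv_apply i j).mul ((measurable_pi_apply j).comp hf)

lemma integrable_inv_apply (hκ : 0 < κ) (hd : 2 * k < d) (i j : Fin k) :
    Integrable (fun θ => (symMatrix θ.2)⁻¹ i j) (niwDistribution κ (0 : Fin k → ℝ) 1 d) := by
  refine (integrable_niwExponent hκ hd 0).mono'
    (measurable_inv_apply i j).aestronglyMeasurable ?_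
  filter_upwards [ae_posDef_niwDistribution κ 0 1 d] with θ hθ
  rw [niwExponent_zero_zero_one]
  exact abs_apply_le_trace hθ.inv.posSemidef i j

lemma integrable_inv_mulVec_fst (hκ : 0 < κ) (hd : 2 * k < d) :
    Integrable (fun θ => (symMatrix θ.2)⁻¹ *ᵥ θ.1) (niwDistribution κ (0 : Fin k → ℝ) 1 d) := by
  refine .of_eval fun i => (integrable_niwExponent hκ hd 1).mono'
    ((measurable_pi_apply i).comp (measurable_inv_mulVec measurable_fst)).aestronglyMeasurable ?_
  filter_upwards [ae_posDef_niwDistribution κ 0 1 d] with θ hθ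
  rw [niwExponent, one_mul, sub_zero, mul_one]
  exact abs_mulVec_apply_le hθ.inv.posSemidef θ.1 i

lemma inv_mulVec_sub_paramMap {A : Matrix (Fin k) (Fin k) ℝ} (hA : A.det ≠ 0) (a v : Fin k → ℝ)
    (θ : (Fin k → ℝ) × SymCoord k) :
    (symMatrix (paramMap A a θ).2)⁻¹ *ᵥ ((paramMap A a θ).1 - v) =
      (A⁻¹)ᵀ *ᵥ ((symMatrix θ.2)⁻¹ *ᵥ (A⁻¹ *ᵥ (a - v)) + (symMatrix θ.2)⁻¹ *ᵥ θ.1) := by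
  have hμ : A⁻¹ *ᵥ (a + A *ᵥ θ.1 - v) = A⁻¹ *ᵥ (a - v) + θ.1 := by
    rw [add_sub_right_comm, Matrix.mulVec_add, Matrix.mulVec_mulVec,
      Matrix.nonsing_inv_mul _ hA.isUnit, Matrix.one_mulVec]
  rw [paramMap, symMatrix_symConj, inv_mul_mul_transpose, ← Matrix.mulVec_mulVec, hμ,
    ← Matrix.mulVec_mulVec, Matrix.mulVec_add]

lemma integral_comp_paramMap_of_mul_transpose_eq_one {A : Matrix (Fin k) (Fin k) ℝ}
    (hA : A * Aᵀ = 1) {E : Type*} [NormedAddCommGroup E] [NormedSpace ℝ E]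
    {f : (Fin k → ℝ) × SymCoord k → E} (hf : StronglyMeasurable f) :
    ∫ θ, f (paramMap A 0 θ) ∂niwDistribution κ (0 : Fin k → ℝ) 1 d =
      ∫ θ, f θ ∂niwDistribution κ (0 : Fin k → ℝ) 1 d := by
  have hdet : A.det ≠ 0 := (Matrix.isUnit_det_of_right_inverse hA).ne_zero
  have hmap := map_paramMap_niwDistribution hdet 0 κ 0 1 d
  rw [mul_one, hA, Matrix.mulVec_zero, add_zero] at hmap
  conv_rhs => rw [← hmap]
  rw [integral_map (measurable_paramMap A 0).aemeasurable hf.aestronglyMeasurable]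

lemma inv_symMatrix_paramMap {A : Matrix (Fin k) (Fin k) ℝ} (hA : A * Aᵀ = 1) (a : Fin k → ℝ)
    (θ : (Fin k → ℝ) × SymCoord k) :
    (symMatrix (paramMap A a θ).2)⁻¹ = A * (symMatrix θ.2)⁻¹ * Aᵀ := by
  rw [paramMap, symMatrix_symConj, inv_mul_mul_transpose, Matrix.inv_eq_right_inv hA,
    Matrix.transpose_transpose]

lemma integral_inv_mulVec_fst (κ d : ℝ) :
    ∫ θ, (symMatrix θ.2)⁻¹ *ᵥ θ.1 ∂niwDistribution κ (0 : Fin k → ℝ) 1 d = 0 := by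
  have hneg : (-1 : Matrix (Fin k) (Fin k) ℝ) * (-1)ᵀ = 1 := by simp
  have h := integral_comp_paramMap_of_mul_transpose_eq_one (κ := κ) (d := d) hneg
    (measurable_inv_mulVec measurable_fst).stronglyMeasurable
  simp only [inv_symMatrix_paramMap hneg] at h
  simpa [paramMap, Matrix.neg_mulVec, Matrix.mulVec_neg, integral_neg, neg_eq_self] using h

lemma integral_inv_apply_of_ne (κ d : ℝ) {i j : Fin k} (hij : i ≠ j) :
    ∫ θ, (symMatrix θ.2)⁻¹ i j ∂niwDistribution κ (0 : Fin k → ℝ) 1 d = 0 := by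
  set A : Matrix (Fin k) (Fin k) ℝ := Matrix.diagonal fun l => if l = i then -1 else 1
  have hA : A * Aᵀ = 1 := by
    rw [Matrix.diagonal_transpose, Matrix.diagonal_mul_diagonal, ← Matrix.diagonal_one]
    congr 1
    ext l
    split_ifs <;> simp
  have h := integral_comp_paramMap_of_mul_transpose_eq_one (κ := κ) (d := d) hA
    (measurable_inv_apply i j).stronglyMeasurable
  simp only [inv_symMatrix_paramMap hA] at h
  simpa [A, hij.symm, integral_neg, neg_eq_self] using h

lemma integral_inv_apply_self_eq (κ d : ℝ) (i j : Fin k) :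
    ∫ θ, (symMatrix θ.2)⁻¹ i i ∂niwDistribution κ (0 : Fin k → ℝ) 1 d =
      ∫ θ, (symMatrix θ.2)⁻¹ j j ∂niwDistribution κ (0 : Fin k → ℝ) 1 d := by
  set A : Matrix (Fin k) (Fin k) ℝ := (Equiv.swap j i).toPEquiv.toMatrix
  have hconj (M : Matrix (Fin k) (Fin k) ℝ) :
      A * M * Aᵀ = M.submatrix (Equiv.swap j i) (Equiv.swap j i) := by
    rw [PEquiv.toMatrix_toPEquiv_mul, ← PEquiv.toMatrix_symm, ← Equiv.toPEquiv_symm,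
      PEquiv.mul_toMatrix_toPEquiv]
    rfl
  have hA : A * Aᵀ = 1 := by simpa using hconj 1
  have h := integral_comp_paramMap_of_mul_transpose_eq_one (κ := κ) (d := d) hA
    (measurable_inv_apply j j).stronglyMeasurable
  simpa only [inv_symMatrix_paramMap hA, hconj, Matrix.submatrix_apply,
    Equiv.swap_apply_left] using h

lemma integral_inv_apply (hκ : 0 < κ) (hd : 2 * k < d) (i j : Fin k) :
    ∫ θ, (symMatrix θ.2)⁻¹ i j ∂niwDistribution κ (0 : Fin k → ℝ) 1 d =
      (d - k - 1) * (1 : Matrix (Fin k) (Fin k) ℝ) i j := by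
  rcases eq_or_ne i j with rfl | hij
  · have htrace := integral_trace_inv (k := k) hκ hd
    simp only [Matrix.trace, Matrix.diag] at htrace
    rw [integral_finsetSum _ fun j _ => integrable_inv_apply hκ hd j j,
      Finset.sum_congr rfl fun j _ => integral_inv_apply_self_eq κ d j i, Finset.sum_const,
      Finset.card_univ, Fintype.card_fin, nsmul_eq_mul] at htrace
    have hk : (k : ℝ) ≠ 0 := Nat.cast_ne_zero.2 i.pos.ne'
    rw [Matrix.one_apply_eq, mul_one]
    exact mul_left_cancel₀ hk htrace
  · rw [integral_inv_apply_of_ne κ d hij, Matrix.one_apply_ne hij, mul_zero]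

lemma integrable_inv_mulVec (hκ : 0 < κ) (hd : 2 * k < d) (u : Fin k → ℝ) :
    Integrable (fun θ => (symMatrix θ.2)⁻¹ *ᵥ u) (niwDistribution κ (0 : Fin k → ℝ) 1 d) := by
  refine .of_eval fun i => ?_
  simp only [Matrix.mulVec, dotProduct]
  exact integrable_finsetSum _ fun j _ => (integrable_inv_apply hκ hd i j).mul_const _

lemma integral_inv_mulVec (hκ : 0 < κ) (hd : 2 * k < d) (u : Fin k → ℝ) :
    ∫ θ, (symMatrix θ.2)⁻¹ *ᵥ u ∂niwDistribution κ (0 : Fin k → ℝ) 1 d = (d - k - 1) • u := by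
  ext i
  rw [eval_integral fun i => (integrable_inv_mulVec hκ hd u).eval i]
  simp only [Matrix.mulVec, dotProduct]
  rw [integral_finsetSum _ fun j _ => (integrable_inv_apply hκ hd i j).mul_const _]
  simp [integral_mul_const, integral_inv_apply hκ hd, Matrix.one_apply]

lemma hasMean_inv_mulVec_sub (hκ : 0 < κ) (hd : 2 * k < d) (m v : Fin k → ℝ)
    {S : Matrix (Fin k) (Fin k) ℝ} (hS : S.PosDef) :
    Integrable (fun θ => (symMatrix θ.2)⁻¹ *ᵥ (θ.1 - v)) (niwDistribution κ m S d) ∧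
      ∫ θ, (symMatrix θ.2)⁻¹ *ᵥ (θ.1 - v) ∂niwDistribution κ m S d =
        (d - k - 1) • (S⁻¹ *ᵥ (m - v)) := by
  obtain ⟨A, hA, rfl⟩ := exists_eq_mul_transpose_of_posDef hS
  have hmap := map_paramMap_niwDistribution hA m κ 0 1 d
  rw [Matrix.mulVec_zero, add_zero, mul_one] at hmap
  have hmeas := (measurable_inv_mulVec (measurable_fst.sub_const v)).stronglyMeasurable
  have hsum : Integrable
      (fun θ => (symMatrix θ.2)⁻¹ *ᵥ (A⁻¹ *ᵥ (m - v)) + (symMatrix θ.2)⁻¹ *ᵥ θ.1)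
      (niwDistribution κ 0 1 d) :=
    (integrable_inv_mulVec hκ hd _).add (integrable_inv_mulVec_fst hκ hd)
  set L := (Matrix.toLin' (A⁻¹)ᵀ).toContinuousLinearMap
  have hcomp : (fun θ => (symMatrix θ.2)⁻¹ *ᵥ (θ.1 - v)) ∘ paramMap A m = fun θ =>
      L ((symMatrix θ.2)⁻¹ *ᵥ (A⁻¹ *ᵥ (m - v)) + (symMatrix θ.2)⁻¹ *ᵥ θ.1) :=
    funext fun θ => inv_mulVec_sub_paramMap hA m v θ
  rw [← hmap]
  constructor
  · rw [integrable_map_measure hmeas.aestronglyMeasurable (measurable_paramMap A m).aemeasurable,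
      hcomp]
    exact L.integrable_comp hsum
  · rw [integral_map (measurable_paramMap A m).aemeasurable hmeas.aestronglyMeasurable]
    calc ∫ θ, ((fun θ => (symMatrix θ.2)⁻¹ *ᵥ (θ.1 - v)) ∘ paramMap A m) θ
          ∂niwDistribution κ 0 1 d
      _ = L ((d - k - 1) • (A⁻¹ *ᵥ (m - v))) := by
        rw [hcomp, L.integral_comp_comm hsum, integral_add (integrable_inv_mulVec hκ hd _)
          (integrable_inv_mulVec_fst hκ hd), integral_inv_mulVec hκ hd,
          integral_inv_mulVec_fst, add_zero]
      _ = (d - k - 1) • ((A * Aᵀ)⁻¹ *ᵥ (m - v)) := by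
        rw [map_smul, Matrix.mul_inv_rev, ← Matrix.transpose_nonsing_inv, ← Matrix.mulVec_mulVec]
        rfl

end Moments

/-! ### Conjugacy of the normal-inverse-Wishart family -/

section ProductOfKernels

variable {ι : Type*} [Fintype ι] [DecidableEq ι]

omit [DecidableEq ι] in
lemma trace_mul_vecMulVec_self {R : Type*} [CommSemiring R] (P : Matrix ι ι R) (v : ι → R) :
    (P * Matrix.vecMulVec v v).trace = v ⬝ᵥ P *ᵥ v := by
  rw [Matrix.mul_vecMulVec, Matrix.trace_vecMulVec, dotProduct_comm]

omit [Fintype ι] [DecidableEq ι] in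
lemma smul_vecMulVec_sub_add_smul_vecMulVec_sub {K : Type*} [Field K] {κ κ' : K}
    (h : κ + κ' ≠ 0) (m m' μ : ι → K) :
    κ • Matrix.vecMulVec (μ - m) (μ - m) + κ' • Matrix.vecMulVec (μ - m') (μ - m') =
      (κ + κ') • Matrix.vecMulVec (μ - (κ + κ')⁻¹ • (κ • m + κ' • m'))
          (μ - (κ + κ')⁻¹ • (κ • m + κ' • m')) +
        (κ * κ' / (κ + κ')) • Matrix.vecMulVec (m' - m) (m' - m) := by
  ext a b
  simp only [Matrix.add_apply, Matrix.smul_apply, Matrix.vecMulVec_apply, Pi.sub_apply,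
    Pi.smul_apply, Pi.add_apply, smul_eq_mul]
  field_simp
  ring

lemma niwExponent_eq_trace (κ : ℝ) (m : ι → ℝ) (S : Matrix ι ι ℝ) (μ : ι → ℝ)
    (Sig : Matrix ι ι ℝ) :
    niwExponent κ m S μ Sig = (Sig⁻¹ * (κ • Matrix.vecMulVec (μ - m) (μ - m) + S)).trace := by
  rw [mul_add, Matrix.trace_add, Matrix.mul_smul, Matrix.trace_smul, trace_mul_vecMulVec_self,
    smul_eq_mul, niwExponent]

lemma niwExponent_add_niwExponent {κ κ' : ℝ} (h : κ + κ' ≠ 0) (m m' : ι → ℝ)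
    (S S' : Matrix ι ι ℝ) (μ : ι → ℝ) (Sig : Matrix ι ι ℝ) :
    niwExponent κ m S μ Sig + niwExponent κ' m' S' μ Sig =
      niwExponent (κ + κ') ((κ + κ')⁻¹ • (κ • m + κ' • m'))
        (S + S' + (κ * κ' / (κ + κ')) • Matrix.vecMulVec (m' - m) (m' - m)) μ Sig := by
  simp only [niwExponent_eq_trace]
  rw [← Matrix.trace_add, ← mul_add, add_add_add_comm,
    smul_vecMulVec_sub_add_smul_vecMulVec_sub h, add_comm (S + S'), add_assoc]

lemma niwDensity_mul_niwDensity {κ κ' : ℝ} (h : κ + κ' ≠ 0) (m m' : ι → ℝ)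
    (S S' : Matrix ι ι ℝ) (d d' : ℝ) (μ : ι → ℝ) {Sig : Matrix ι ι ℝ} (hSig : 0 < Sig.det) :
    niwDensity κ m S d μ Sig * niwDensity κ' m' S' d' μ Sig =
      niwDensity (κ + κ') ((κ + κ')⁻¹ • (κ • m + κ' • m'))
        (S + S' + (κ * κ' / (κ + κ')) • Matrix.vecMulVec (m' - m) (m' - m)) (d + d' + 1) μ
        Sig := by
  rw [niwDensity, niwDensity, niwDensity, mul_mul_mul_comm, ← Real.rpow_add hSig, ← Real.exp_add,
    ← niwExponent_add_niwExponent h]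
  ring_nf

end ProductOfKernels

section Data

variable {k n : ℕ}

lemma sum_sub_sampleMean (x : Fin n → Fin k → ℝ) : ∑ i, (x i - sampleMean x) = 0 := by
  rcases n.eq_zero_or_pos with rfl | hn
  · exact Fintype.sum_empty _
  · rw [Finset.sum_sub_distrib, Finset.sum_const, Finset.card_univ, Fintype.card_fin, sampleMean,
      ← Nat.cast_smul_eq_nsmul ℝ, smul_inv_smul₀ (by positivity), sub_self]

lemma scatterD_eq_sum (x : Fin n → Fin k → ℝ) :
    scatterD x = ∑ i, Matrix.vecMulVec (x i - sampleMean x) (x i - sampleMean x) := by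
  rcases eq_or_ne n 1 with rfl | hn
  · have h := sum_sub_sampleMean x
    rw [Fin.sum_univ_one] at h
    simp [scatterD, h]
  · rw [scatterD, sampleCov, smul_inv_smul₀ (sub_ne_zero.2 (Nat.cast_ne_one.2 hn))]

lemma scatterD_eq_transpose_mul (x : Fin n → Fin k → ℝ) :
    scatterD x =
      (Matrix.of fun i => x i - sampleMean x)ᵀ * Matrix.of fun i => x i - sampleMean x := by
  ext a b
  simp [scatterD_eq_sum, Matrix.sum_apply, Matrix.mul_apply, Matrix.vecMulVec_apply]

lemma posSemidef_scatterD (x : Fin n → Fin k → ℝ) : (scatterD x).PosSemidef := by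
  rw [scatterD_eq_transpose_mul]
  exact Matrix.posSemidef_conjTranspose_mul_self _

lemma lt_of_isUnit_det_scatterD (hk : 0 < k) {x : Fin n → Fin k → ℝ}
    (hx : IsUnit (scatterD x).det) : k < n := by
  set Y : Matrix (Fin n) (Fin k) ℝ := Matrix.of fun i => x i - sampleMean x
  have hrank : Y.rank = k := by
    rw [← Matrix.rank_transpose_mul_self, ← scatterD_eq_transpose_mul,
      Matrix.rank_of_isUnit _ ((Matrix.isUnit_iff_isUnit_det _).2 hx), Fintype.card_fin]
  by_contra! hnk
  have hindep : LinearIndependent ℝ Y.row := by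
    rw [linearIndependent_iff_card_le_finrank_span, Fintype.card_fin, Set.finrank,
      ← Matrix.rank_eq_finrank_span_row, hrank]
    exact hnk
  have hsum : ∑ i, (1 : ℝ) • Y.row i = 0 := by
    simp only [one_smul]
    exact sum_sub_sampleMean x
  have hn : 0 < n := hk.trans_le (hrank ▸ Y.rank_le_height)
  exact one_ne_zero (Fintype.linearIndependent_iff.1 hindep _ hsum ⟨0, hn⟩)

lemma sum_vecMulVec_sub (x : Fin n → Fin k → ℝ) (μ : Fin k → ℝ) :
    ∑ i, Matrix.vecMulVec (x i - μ) (x i - μ) =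
      (n : ℝ) • Matrix.vecMulVec (μ - sampleMean x) (μ - sampleMean x) + scatterD x := by
  set v := μ - sampleMean x
  have hleft : ∑ i, Matrix.vecMulVec (x i - sampleMean x) v = 0 := by
    refine (map_sum ((vecMulVecBilin ℝ ℝ).flip v) _ _).symm.trans ?_
    rw [sum_sub_sampleMean, map_zero]
  have hright : ∑ i, Matrix.vecMulVec v (x i - sampleMean x) = 0 := by
    refine (map_sum (vecMulVecBilin ℝ ℝ v) _ _).symm.trans ?_
    rw [sum_sub_sampleMean, map_zero]
  have hexpand (i : Fin n) : Matrix.vecMulVec (x i - μ) (x i - μ) =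
      Matrix.vecMulVec (x i - sampleMean x) (x i - sampleMean x) -
        Matrix.vecMulVec (x i - sampleMean x) v - Matrix.vecMulVec v (x i - sampleMean x) +
          Matrix.vecMulVec v v := by
    ext a b
    simp only [v, Matrix.add_apply, Matrix.sub_apply, Matrix.vecMulVec_apply, Pi.sub_apply]
    ring
  simp only [hexpand, Finset.sum_add_distrib, Finset.sum_sub_distrib, ← scatterD_eq_sum, hleft,
    hright, sub_zero, Finset.sum_const, Finset.card_univ, Fintype.card_fin,
    ← Nat.cast_smul_eq_nsmul ℝ]
  exact add_comm _ _

lemma likelihood_eq (x : Fin n → Fin k → ℝ) (μ : Fin k → ℝ) {Sig : Matrix (Fin k) (Fin k) ℝ}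
    (hSig : 0 ≤ Sig.det) :
    likelihood x μ Sig = ((2 * Real.pi) ^ (-(k : ℝ) / 2)) ^ n *
      niwDensity n (sampleMean x) (scatterD x) (n - 1) μ Sig := by
  have hexp : ∑ i, (x i - μ) ⬝ᵥ Sig⁻¹ *ᵥ (x i - μ) =
      niwExponent n (sampleMean x) (scatterD x) μ Sig := by
    rw [niwExponent_eq_trace, ← sum_vecMulVec_sub, Matrix.mul_sum, Matrix.trace_sum]
    simp only [trace_mul_vecMulVec_self]
  simp only [likelihood, gaussianDensity]
  rw [Finset.prod_mul_distrib, Finset.prod_const, Finset.card_univ, Fintype.card_fin, mul_pow,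
    ← Real.exp_sum, ← Finset.sum_div, Finset.sum_neg_distrib, hexp, ← Real.rpow_mul_natCast hSig,
    mul_assoc, niwDensity]
  ring_nf

lemma multiGamma_pos {a : ℝ} (ha : (k : ℝ) - 1 < 2 * a) : 0 < multiGamma k a := by
  refine mul_pos (Real.rpow_pos_of_pos Real.pi_pos _)
    (Finset.prod_pos fun i _ => Real.Gamma_pos_of_pos ?_)
  have : (i : ℝ) + 1 ≤ k := by exact_mod_cast i.isLt
  linarith

lemma exists_pos_conjugatePrior_eq (m₀ : Fin k → ℝ) {r₀ d₀ : ℝ} (hr : 0 < r₀) (hd : 2 * k < d₀)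
    {S₀ : Matrix (Fin k) (Fin k) ℝ} (hS : S₀.PosDef) :
    ∃ C : ℝ, 0 < C ∧ ∀ (μ : Fin k → ℝ) (Sig : Matrix (Fin k) (Fin k) ℝ), Sig.PosDef →
      conjugatePrior m₀ r₀ d₀ S₀ μ Sig = C * niwDensity r₀ m₀ S₀ d₀ μ Sig := by
  have hΓ : 0 < multiGamma k ((d₀ - k - 1) / 2) := multiGamma_pos (by linarith)
  have hS_det := hS.det_pos
  refine ⟨(2 * Real.pi) ^ (-(k : ℝ) / 2) * (r₀⁻¹ ^ k) ^ (-(1 : ℝ) / 2) *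
    (S₀.det ^ ((d₀ - k - 1) / 2) /
      (2 ^ ((k : ℝ) * (d₀ - k - 1) / 2) * multiGamma k ((d₀ - k - 1) / 2))), by positivity,
    fun μ Sig hSig => ?_⟩
  have hinv : (r₀⁻¹ • Sig)⁻¹ = r₀ • Sig⁻¹ := by
    refine Matrix.inv_eq_right_inv ?_
    rw [smul_mul_smul_comm, inv_mul_cancel₀ hr.ne', one_smul,
      Matrix.mul_nonsing_inv _ hSig.det_pos.ne'.isUnit]
  rw [conjugatePrior, gaussianDensity, invWishartDensity, niwDensity, niwExponent, hinv,
    Matrix.det_smul, Fintype.card_fin, Real.mul_rpow (by positivity) hSig.det_pos.le,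
    Matrix.smul_mulVec, dotProduct_smul, smul_eq_mul, neg_add, neg_add, add_div, add_div,
    Real.rpow_add hSig.det_pos, Real.exp_add]
  ring

lemma diffusePrior_eq (m μ : Fin k → ℝ) (Sig : Matrix (Fin k) (Fin k) ℝ) :
    diffusePrior μ Sig = niwDensity 0 m 0 k μ Sig := by
  simp [diffusePrior, niwDensity, niwExponent]

lemma posDef_scatterC (x : Fin n → Fin k → ℝ) (m₀ : Fin k → ℝ) {r₀ : ℝ} (hr : 0 ≤ r₀)
    {S₀ : Matrix (Fin k) (Fin k) ℝ} (hS : (scatterD x + S₀).PosDef) :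
    (scatterC m₀ r₀ S₀ x).PosDef := by
  have h := Matrix.posSemidef_vecMulVec_self_star (m₀ - sampleMean x)
  rw [star_trivial] at h
  exact hS.add_posSemidef (h.smul (by positivity))

end Data

section Posterior

variable {k n : ℕ} {prior : (Fin k → ℝ) → Matrix (Fin k) (Fin k) ℝ → ℝ} {C r₀ d₀ : ℝ}
  {m₀ : Fin k → ℝ} {S₀ : Matrix (Fin k) (Fin k) ℝ}

lemma posterior_eq_niwDistribution (hC : 0 < C)
    (hprior : ∀ (μ : Fin k → ℝ) (Sig : Matrix (Fin k) (Fin k) ℝ), Sig.PosDef →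
      prior μ Sig = C * niwDensity r₀ m₀ S₀ d₀ μ Sig)
    (hr : (n : ℝ) + r₀ ≠ 0) (x : Fin n → Fin k → ℝ) :
    posterior prior x =
      niwDistribution (n + r₀) (meanC m₀ r₀ x) (scatterC m₀ r₀ S₀ x) (n + d₀) := by
  set c : ℝ := ((2 * Real.pi) ^ (-(k : ℝ) / 2)) ^ n * C
  have hc : 0 < c := by positivity
  have hdensity (μ : Fin k → ℝ) {Sig : Matrix (Fin k) (Fin k) ℝ} (hSig : Sig.PosDef) :
      likelihood x μ Sig * prior μ Sig =
        c * niwDensity (n + r₀) (meanC m₀ r₀ x) (scatterC m₀ r₀ S₀ x) (n + d₀) μ Sig := by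
    rw [likelihood_eq x μ hSig.det_pos.le, hprior μ Sig hSig, mul_mul_mul_comm,
      niwDensity_mul_niwDensity hr _ _ _ _ _ _ _ hSig.det_pos, sub_add_eq_add_sub,
      sub_add_cancel]
    rfl
  have hunnorm : unnormPosterior prior x = ENNReal.ofReal c •
      niwMeasure (n + r₀) (meanC m₀ r₀ x) (scatterC m₀ r₀ S₀ x) (n + d₀) := by
    rw [unnormPosterior, niwMeasure,
      ← withDensity_smul _ (measurable_niwDensity _ _ _ _).ennreal_ofReal]
    refine withDensity_congr_ae ?_
    filter_upwards [ae_posDef_paramMeasure] with θ hθ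
    rw [hdensity θ.1 hθ, ENNReal.ofReal_mul hc.le, Pi.smul_apply, smul_eq_mul]
  rw [posterior, hunnorm, inv_univ_smul_smul (ENNReal.ofReal_pos.2 hc).ne' ENNReal.ofReal_ne_top,
    niwDistribution]

lemma hasPosteriorMean_weight (hC : 0 < C)
    (hprior : ∀ (μ : Fin k → ℝ) (Sig : Matrix (Fin k) (Fin k) ℝ), Sig.PosDef →
      prior μ Sig = C * niwDensity r₀ m₀ S₀ d₀ μ Sig)
    {x : Fin n → Fin k → ℝ} (hr : 0 < (n : ℝ) + r₀) (hd : 2 * (k : ℝ) < n + d₀)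
    (hS : (scatterC m₀ r₀ S₀ x).PosDef) (γ W : ℝ) (r : ℕ → ℝ) (T t : ℕ) :
    HasPosteriorMean prior x (weight γ r T t W)
      ((coefC γ r T t W * ((n : ℝ) + d₀ - k - 1)) •
        ((scatterC m₀ r₀ S₀ x)⁻¹ *ᵥ fun i => meanC m₀ r₀ x i - r (t + 1))) := by
  obtain ⟨hint, hmean⟩ :=
    hasMean_inv_mulVec_sub hr hd (meanC m₀ r₀ x) (fun _ => r (t + 1)) hS
  rw [HasPosteriorMean, posterior_eq_niwDistribution hC hprior hr.ne' x]
  refine ⟨isProbabilityMeasure_niwDistribution hr hd _ hS, hint.smul (coefC γ r T t W), ?_⟩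
  rw [mul_smul]
  exact (integral_smul _ _).trans (congrArg (coefC γ r T t W • ·) hmean)

lemma hasPosteriorMean_weight_diffusePrior (hk : 0 < k) {x : Fin n → Fin k → ℝ}
    (hx : IsUnit (scatterD x).det) (γ W : ℝ) (r : ℕ → ℝ) (T t : ℕ) :
    HasPosteriorMean diffusePrior x (weight γ r T t W)
      ((coefC γ r T t W * ((n : ℝ) - 1)) •
        ((scatterD x)⁻¹ *ᵥ fun i => sampleMean x i - r (t + 1))) := by
  have hkn : (k : ℝ) < n := Nat.cast_lt.2 (lt_of_isUnit_det_scatterD hk hx)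
  have hn : (0 : ℝ) < n := k.cast_nonneg.trans_lt hkn
  have hmean : meanC 0 0 x = sampleMean x := by
    rw [meanC, zero_smul, add_zero, add_zero, inv_smul_smul₀ hn.ne']
  have hscatter : scatterC 0 0 0 x = scatterD x := by
    rw [scatterC, mul_zero, zero_div, zero_smul, add_zero, add_zero]
  have hS : (scatterD x).PosDef :=
    (posSemidef_scatterD x).posDef_iff_isUnit.2 ((Matrix.isUnit_iff_isUnit_det _).2 hx)
  have h := hasPosteriorMean_weight one_pos
    (fun μ Sig _ => (diffusePrior_eq 0 μ Sig).trans (one_mul _).symm) (x := x)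
    (by simpa using hn) (by linarith) (hscatter ▸ hS) γ W r T t
  rwa [hmean, hscatter, add_sub_cancel_right] at h

lemma hasPosteriorMean_weight_conjugatePrior (m₀ : Fin k → ℝ) (hr : 0 < r₀) (hd : 2 * k < d₀)
    (hS : S₀.PosDef) (x : Fin n → Fin k → ℝ) (γ W : ℝ) (r : ℕ → ℝ) (T t : ℕ) :
    HasPosteriorMean (conjugatePrior m₀ r₀ d₀ S₀) x (weight γ r T t W)
      ((coefC γ r T t W * ((n : ℝ) + d₀ - k - 1)) •
        ((scatterC m₀ r₀ S₀ x)⁻¹ *ᵥ fun i => meanC m₀ r₀ x i - r (t + 1))) := by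
  obtain ⟨C, hC, hprior⟩ := exists_pos_conjugatePrior_eq m₀ hr hd hS
  exact hasPosteriorMean_weight hC hprior (by positivity)
    (by linarith [(n.cast_nonneg : (0 : ℝ) ≤ n)])
    (posDef_scatterC x m₀ hr.le (Matrix.PosDef.posSemidef_add (posSemidef_scatterD x) hS))
    γ W r T t

end Posterior

end BayesPortfolio

theorem theorem3_general {k n T t : ℕ} (hk : 0 < k) (ht : t < T)
    (γ W : ℝ) (r : ℕ → ℝ) (hγ : γ ≠ 0) (hW : W ≠ 0)
    (hr : ∀ i ∈ Finset.Icc (t + 1) T, 1 + r i ≠ 0)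
    (x : Fin n → Fin k → ℝ) :
    (∀ (μ : Fin k → ℝ) (Sig : Matrix (Fin k) (Fin k) ℝ), Sig.PosDef → ∀ v : Fin k → ℝ,
      IsOptimalWeight γ r T t W μ Sig v ↔ v = weight γ r T t W μ Sig) ∧
    (IsUnit (scatterD x).det →
      HasPosteriorMean diffusePrior x (weight γ r T t W)
        ((coefC γ r T t W * ((n : ℝ) - 1)) •
          ((scatterD x)⁻¹ *ᵥ fun i => sampleMean x i - r (t + 1)))) ∧
    (∀ (m₀ : Fin k → ℝ) (r₀ d₀ : ℝ) (S₀ : Matrix (Fin k) (Fin k) ℝ),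
      0 < r₀ → 2 * (k : ℝ) < d₀ → S₀.PosDef →
      HasPosteriorMean (conjugatePrior m₀ r₀ d₀ S₀) x (weight γ r T t W)
        ((coefC γ r T t W * ((n : ℝ) + d₀ - k - 1)) •
          ((scatterC m₀ r₀ S₀ x)⁻¹ *ᵥ fun i => meanC m₀ r₀ x i - r (t + 1)))) :=
  ⟨fun μ _ hSig => isOptimalWeight_iff μ hSig hγ hW ht hr,
    fun hx => hasPosteriorMean_weight_diffusePrior hk hx γ W r T t,
    fun m₀ _ _ _ hr₀ hd₀ hS₀ => hasPosteriorMean_weight_conjugatePrior m₀ hr₀ hd₀ hS₀ x γ W r T t⟩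

theorem theorem3 {k n T t : ℕ} (hk : 0 < k) (hn : k < n) (ht : t < T)
    (γ W : ℝ) (r : ℕ → ℝ) (hγ : 0 < γ) (hW : W ≠ 0)
    (hr : ∀ i ∈ Finset.Icc (t + 1) T, 1 + r i ≠ 0)
    (x : Fin n → Fin k → ℝ) :
    -- the weights `w_t` are the unique optimal ones
    (∀ (μ : Fin k → ℝ) (Sig : Matrix (Fin k) (Fin k) ℝ), Sig.PosDef → ∀ v : Fin k → ℝ,
      IsOptimalWeight γ r T t W μ Sig v ↔ v = weight γ r T t W μ Sig) ∧
    -- diffuse prior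
    (IsUnit (scatterD x).det →
      HasPosteriorMean diffusePrior x (weight γ r T t W)
        ((coefC γ r T t W * ((n : ℝ) - 1)) •
          ((scatterD x)⁻¹ *ᵥ fun i => sampleMean x i - r (t + 1)))) ∧
    -- conjugate prior
    (∀ (m₀ : Fin k → ℝ) (r₀ d₀ : ℝ) (S₀ : Matrix (Fin k) (Fin k) ℝ),
      0 < r₀ → 2 * (k : ℝ) < d₀ → S₀.PosDef →
      HasPosteriorMean (conjugatePrior m₀ r₀ d₀ S₀) x (weight γ r T t W)
        ((coefC γ r T t W * ((n : ℝ) + d₀ - k - 1)) •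
          ((scatterC m₀ r₀ S₀ x)⁻¹ *ᵥ fun i => meanC m₀ r₀ x i - r (t + 1)))) :=
  theorem3_general hk ht γ W r hγ.ne' hW hr x
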